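/- Let $n$ be a positive integer, let $R$ be an integral domain (commutative), and let $q_1,q_2$ be units of $R$. Let $B_n$ be the braid group with generators $\sigma_1,\dots,\sigma_{n-1}$ and relations $\sigma_i\sigma_j=\sigma_j\sigma_i$ if $|i-j|>1$, $\sigma_i\sigma_j\sigma_i=\sigma_j\sigma_i\sigma_j$ if $|i-j|=1$. Let $\mathcal H_n=\mathcal H_n(q_1,q_2)$ be the associative unital $R$-algebra with generators $T_1,\dots,T_{n-1}$ and relations $T_iT_j=T_jT_i$ if $|i-j|>1$, $T_iT_jT_i=T_jT_iT_j$ if $|i-j|=1$, and $(T_i-q_1)(T_i-q_2)=0$; each $T_i$ is a unit, and $\sigma_i\mapsto T_i$ defines a homomorphism from $B_n$ to the group of units of $\mathcal H_n$. Let $V$ be the quotient of $\mathcal H_n$ by the $R$-submodule spanned by all $ab-ba$ with $a,b\in\mathcal H_n$. The closure of a braid, which up to equivalence is its conjugacy class in $B_n$, represents the class in $V$ of the image of the braid in $\mathcal H_n$. For $m>0$ let $b_{(m)}=\sigma_{m-1}\cdots\sigma_2\sigma_1\in B_m$. For a partition $\lambda=(\lambda_1\ge\dots\ge\lambda_k>0)$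 of $n$ let $b_\lambda\in B_n$ be the disjoint union of $b_{(\lambda_1)},\dots,b_{(\lambda_k)}$, placed in order from left to right, and let $v_\lambda$ be the closure of $b_\lambda$. Then the elements of $V$ represented by the $v_\lambda$, where $\lambda$ runs over the partitions of $n$ (one basis element for each partition), form a basis of the $R$-module $V$. Consequently, the map that sends a trace function $\operatorname{tr}$ (an $R$-linear map $\operatorname{tr}\colon\mathcal H_n\to R$ with $\operatorname{tr}(ab)=\operatorname{tr}(ba)$ for all $a,b\in\mathcal H_n$) to the function $\lambda\mapsto\operatorname{tr}(b_\lambda)$, where $b_\lambda$ also denotes its image in $\mathcal H_n$, is an $R$-linear isomorphism from the $R$-module of trace functions on $\mathcal H_n$ to the $R$-module of all functions from the set of partitions of $n$ to $R$. -/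

import Mathlib

/-! Braid groups, Iwahori-Hecke algebras, their quotient by commutators, and closed braids. -/

namespace IwahoriHecke

/-- The index set `{1, …, n - 1}` of the standard generators. -/
abbrev Gen (n : ℕ) : Type := {i : ℕ // 0 < i ∧ i < n}

/-! ### The braid group -/

/-- The defining relators of the braid group on `n` strands:
`σ_i σ_j = σ_j σ_i` if `|i - j| > 1`, and `σ_i σ_j σ_i = σ_j σ_i σ_j` if `|i - j| = 1`. -/
def braidRels (n : ℕ) : Set (FreeGroup (Gen n)) :=
  {r | (∃ i j : Gen n, 1 < |(i.1 : ℤ) - (j.1 : ℤ)| ∧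
          r = (FreeGroup.of i * FreeGroup.of j) * (FreeGroup.of j * FreeGroup.of i)⁻¹) ∨
       (∃ i j : Gen n, |(i.1 : ℤ) - (j.1 : ℤ)| = 1 ∧
          r = (FreeGroup.of i * FreeGroup.of j * FreeGroup.of i) *
              (FreeGroup.of j * FreeGroup.of i * FreeGroup.of j)⁻¹)}

/-- The braid group `B_n`, by its standard presentation. -/
abbrev BraidGroup (n : ℕ) : Type := PresentedGroup (braidRels n)

/-- The standard generator `σ_i` of `B_n`, `1 ≤ i ≤ n - 1`. -/
def sigma {n : ℕ} (i : Gen n) : BraidGroup n := PresentedGroup.of i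

theorem sigma_comm {n : ℕ} (i j : Gen n) (h : 1 < |(i.1 : ℤ) - (j.1 : ℤ)|) :
    sigma i * sigma j = sigma j * sigma i :=
  mul_inv_eq_one.mp (PresentedGroup.one_of_mem (rels := braidRels n) (Or.inl ⟨i, j, h, rfl⟩))

theorem sigma_braid {n : ℕ} (i j : Gen n) (h : |(i.1 : ℤ) - (j.1 : ℤ)| = 1) :
    sigma i * sigma j * sigma i = sigma j * sigma i * sigma j :=
  mul_inv_eq_one.mp (PresentedGroup.one_of_mem (rels := braidRels n) (Or.inr ⟨i, j, h, rfl⟩))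

/-- The universal property of `B_n`. -/
def BraidGroup.lift {n : ℕ} {G : Type*} [Group G] (f : Gen n → G)
    (hc : ∀ i j : Gen n, 1 < |(i.1 : ℤ) - (j.1 : ℤ)| → f i * f j = f j * f i)
    (hb : ∀ i j : Gen n, |(i.1 : ℤ) - (j.1 : ℤ)| = 1 → f i * f j * f i = f j * f i * f j) :
    BraidGroup n →* G :=
  PresentedGroup.toGroup (f := f) (rels := braidRels n) (by
    rintro r (⟨i, j, h, rfl⟩ | ⟨i, j, h, rfl⟩)
    · simpa using mul_inv_eq_one.mpr (hc i j h)
    · simpa using mul_inv_eq_one.mpr (hb i j h))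

/-- Place a braid with `m` strands on the strands `k + 1, …, k + m` of a braid with `n` strands,
all the other strands being vertical; that is, `σ_i ↦ σ_{k + i}`. -/
def place {m n : ℕ} (k : ℕ) (h : k + m ≤ n) : BraidGroup m →* BraidGroup n :=
  BraidGroup.lift (fun i => sigma ⟨k + i.1, by have := i.2; omega⟩)
    (fun i j hij => sigma_comm _ _ (by simpa using hij))
    (fun i j hij => sigma_braid _ _ (by simpa using hij))

/-- The braid `b_(m) = σ_{m-1} ⋯ σ_2 σ_1` with `m` strands. -/
def cycleBraid (m : ℕ) : BraidGroup m :=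
  (List.ofFn fun j : Fin (m - 1) => sigma (n := m) ⟨m - 1 - j.1, by have := j.2; omega⟩).prod

/-- The disjoint union, in order from left to right, of the braids `b_(m)` for `m` in the list `l`,
placed on the strands `k + 1, …, k + l.sum` of a braid with `n` strands. -/
def disjointCycles (n : ℕ) : (k : ℕ) → (l : List ℕ) → k + l.sum ≤ n → BraidGroup n
  | _, [], _ => 1
  | k, m :: l, h =>
      place k (by rw [List.sum_cons] at h; omega) (cycleBraid m) *
        disjointCycles n (k + m) l (by rw [List.sum_cons] at h; omega)

/-- The parts `λ_1 ≥ λ_2 ≥ ⋯ ≥ λ_k > 0` of a partition, as a list in that order. -/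
def partList {n : ℕ} (p : n.Partition) : List ℕ := p.parts.sort (· ≥ ·)

theorem sum_partList {n : ℕ} (p : n.Partition) : (partList p).sum = n := by
  rw [← Multiset.sum_coe, partList, Multiset.sort_eq, p.parts_sum]

/-- The braid `b_λ`: the disjoint union of the braids `b_(λ_i)`, in order from left to right. -/
def partitionBraid {n : ℕ} (p : n.Partition) : BraidGroup n :=
  disjointCycles n 0 (partList p) (by rw [sum_partList, zero_add])

/-- Closed `n`-braids up to equivalence: the conjugacy classes of `B_n`
(two braids have equivalent closures if and only if they are conjugate). -/
abbrev ClosedBraid (n : ℕ) : Type := ConjClasses (BraidGroup n)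

/-- The closure of a braid. -/
def closure {n : ℕ} (b : BraidGroup n) : ClosedBraid n := ConjClasses.mk b

/-- The closed braid `v_λ`, the closure of `b_λ`. -/
def partitionClosedBraid {n : ℕ} (p : n.Partition) : ClosedBraid n := closure (partitionBraid p)

/-! ### The Iwahori-Hecke algebra -/

section Hecke

variable {R : Type*} [CommRing R]

/-- The defining relations of the Iwahori-Hecke algebra `H_n(q₁, q₂)`. -/
inductive HeckeRel (n : ℕ) (q₁ q₂ : Rˣ) :
    FreeAlgebra R (Gen n) → FreeAlgebra R (Gen n) → Prop
  | comm (i j : Gen n) (h : 1 < |(i.1 : ℤ) - (j.1 : ℤ)|) :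
      HeckeRel n q₁ q₂ (FreeAlgebra.ι R i * FreeAlgebra.ι R j)
        (FreeAlgebra.ι R j * FreeAlgebra.ι R i)
  | braid (i j : Gen n) (h : |(i.1 : ℤ) - (j.1 : ℤ)| = 1) :
      HeckeRel n q₁ q₂ (FreeAlgebra.ι R i * FreeAlgebra.ι R j * FreeAlgebra.ι R i)
        (FreeAlgebra.ι R j * FreeAlgebra.ι R i * FreeAlgebra.ι R j)
  | quad (i : Gen n) :
      HeckeRel n q₁ q₂
        ((FreeAlgebra.ι R i - algebraMap R _ (q₁ : R)) *
          (FreeAlgebra.ι R i - algebraMap R _ (q₂ : R))) 0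

/-- The Iwahori-Hecke algebra `H_n(q₁, q₂)` over `R`: the associative unital `R`-algebra with
generators `T_1, …, T_{n-1}` and the above relations. -/
abbrev HeckeAlgebra (n : ℕ) (q₁ q₂ : Rˣ) : Type _ := RingQuot (HeckeRel n q₁ q₂)

/-- The generator `T_i` of `H_n(q₁, q₂)`. -/
def T {n : ℕ} (q₁ q₂ : Rˣ) (i : Gen n) : HeckeAlgebra n q₁ q₂ :=
  RingQuot.mkAlgHom R (HeckeRel n q₁ q₂) (FreeAlgebra.ι R i)

variable {n : ℕ} (q₁ q₂ : Rˣ)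

theorem T_comm (i j : Gen n) (h : 1 < |(i.1 : ℤ) - (j.1 : ℤ)|) :
    T q₁ q₂ i * T q₁ q₂ j = T q₁ q₂ j * T q₁ q₂ i := by
  simpa [T] using RingQuot.mkAlgHom_rel R (HeckeRel.comm (q₁ := q₁) (q₂ := q₂) i j h)

theorem T_braid (i j : Gen n) (h : |(i.1 : ℤ) - (j.1 : ℤ)| = 1) :
    T q₁ q₂ i * T q₁ q₂ j * T q₁ q₂ i = T q₁ q₂ j * T q₁ q₂ i * T q₁ q₂ j := by
  simpa [T] using RingQuot.mkAlgHom_rel R (HeckeRel.braid (q₁ := q₁) (q₂ := q₂) i j h)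

theorem T_quad (i : Gen n) :
    (T q₁ q₂ i - algebraMap R _ (q₁ : R)) * (T q₁ q₂ i - algebraMap R _ (q₂ : R)) = 0 := by
  have h := RingQuot.mkAlgHom_rel R (HeckeRel.quad (q₁ := q₁) (q₂ := q₂) i)
  rw [map_mul, map_sub, map_sub, AlgHom.commutes, AlgHom.commutes, map_zero] at h
  exact h

/-- The inverse `(q₁ + q₂ - T_i) / (q₁ q₂)` of `T_i`. -/
def Tinv (i : Gen n) : HeckeAlgebra n q₁ q₂ :=
  ((q₁ * q₂)⁻¹ : Rˣ).1 • (algebraMap R _ ((q₁ : R) + q₂) - T q₁ q₂ i)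

theorem T_mul_Tinv (i : Gen n) : T q₁ q₂ i * Tinv q₁ q₂ i = 1 := by
  have h := T_quad q₁ q₂ i
  have h2 : T q₁ q₂ i * (algebraMap R _ ((q₁ : R) + q₂) - T q₁ q₂ i) =
      algebraMap R _ ((q₁ * q₂ : Rˣ) : R) := by
    have e := Algebra.commutes (q₁ : R) (T q₁ q₂ i)
    rw [Units.val_mul, map_mul, map_add, ← sub_eq_zero, ← neg_eq_zero, ← h]
    simp only [sub_mul, mul_sub, mul_add, e]
    abel
  rw [Tinv, mul_smul_comm, h2, Algebra.smul_def, ← map_mul, Units.inv_mul, map_one]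

theorem Tinv_mul_T (i : Gen n) : Tinv q₁ q₂ i * T q₁ q₂ i = 1 := by
  rw [← T_mul_Tinv q₁ q₂ i, Tinv, mul_smul_comm, smul_mul_assoc, sub_mul, mul_sub,
    Algebra.commutes]

/-- `T_i` as a unit of `H_n(q₁, q₂)`. -/
def Tunit (i : Gen n) : (HeckeAlgebra n q₁ q₂)ˣ :=
  ⟨T q₁ q₂ i, Tinv q₁ q₂ i, T_mul_Tinv q₁ q₂ i, Tinv_mul_T q₁ q₂ i⟩

/-- The homomorphism from `B_n` to the group of units of `H_n(q₁, q₂)` with `σ_i ↦ T_i`. -/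
def braidToHecke : BraidGroup n →* (HeckeAlgebra n q₁ q₂)ˣ :=
  BraidGroup.lift (Tunit q₁ q₂)
    (fun i j h => Units.ext (T_comm q₁ q₂ i j h))
    (fun i j h => Units.ext (T_braid q₁ q₂ i j h))

/-! ### The quotient by commutators, and trace functions -/

/-- The `R`-submodule of `H_n(q₁, q₂)` spanned by the elements `a b - b a`. -/
def commutatorSpan (n : ℕ) (q₁ q₂ : Rˣ) : Submodule R (HeckeAlgebra n q₁ q₂) :=
  Submodule.span R {x | ∃ a b : HeckeAlgebra n q₁ q₂, x = a * b - b * a}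

/-- The quotient `V` of `H_n(q₁, q₂)` by the span of the commutators. -/
abbrev V (n : ℕ) (q₁ q₂ : Rˣ) : Type _ := HeckeAlgebra n q₁ q₂ ⧸ commutatorSpan n q₁ q₂

/-- The element of `V` represented by a closed braid: the closure of a braid `b` represents the
class of the image of `b` in `H_n(q₁, q₂)`. -/
def closedBraidClass : ClosedBraid n → V n q₁ q₂ :=
  Quotient.lift
    (fun b : BraidGroup n => (commutatorSpan n q₁ q₂).mkQ (braidToHecke q₁ q₂ b).1) (by
      intro b b' h
      obtain ⟨c, rfl⟩ := isConj_iff.mp (show IsConj b b' from h)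
      refine (Submodule.Quotient.eq _).mpr (Submodule.subset_span
        ⟨(braidToHecke q₁ q₂ (b * c⁻¹)).1, (braidToHecke q₁ q₂ c).1, ?_⟩)
      rw [← Units.val_mul, ← Units.val_mul, ← map_mul, ← map_mul, inv_mul_cancel_right,
        mul_assoc])

/-- The `R`-module of trace functions on `H_n(q₁, q₂)`: the `R`-linear maps `tr` to `R` with
`tr (a b) = tr (b a)` for all `a` and `b`. -/
def traceFunctions (n : ℕ) (q₁ q₂ : Rˣ) : Submodule R (HeckeAlgebra n q₁ q₂ →ₗ[R] R) where
  carrier := {tr | ∀ a b, tr (a * b) = tr (b * a)}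
  add_mem' {f g} hf hg a b := by
    rw [LinearMap.add_apply, LinearMap.add_apply, hf a b, hg a b]
  zero_mem' _ _ := rfl
  smul_mem' c f hf a b := by
    rw [LinearMap.smul_apply, LinearMap.smul_apply, hf a b]

end Hecke

end IwahoriHecke

/-! Spanning. Write `H_k` for the subalgebra of the first `k` strands. The quadratic and braid
relations give `H_{k+2} ⊆ H_{k+1} + H_{k+1} t_k H_{k+1}` (`strandAlg_le_bruhatSpan`). Modulo
commutators, the factors from `H_{k+1}` can be carried around the closure, which turns an element of
`H_n` into a combination of products of descending cycles on consecutive blocks, one product for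
each composition of `n` (`strandAlg_le_blockSpan`). Permuting the blocks conjugates such a braid
already in `B_n`, by powers of `σ_1 ⋯ σ_r` on the strands concerned
(`IsBraidSeq.exists_semiconjBy_blocks`), so partitions suffice (`span_partitionClass`).

Independence. The algebra acts by an R-matrix on the functions on words of length `n` in `n`
letters, preserving the multiset of multiplicities of the letters. The trace on each content is
therefore a trace function (`contentTrace`), and these traces, evaluated at the `b_λ`, form a square
matrix indexed by partitions. At `q₁ = 1`, `q₂ = -1` the action is by permuting positions, and an
entry counts the words of a given content fixed by a permutation of cycle type `λ`. A fixed word is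
constant on cycles, so its content has at most as many parts as `λ`, and equals `λ` if it has as
many. The integral matrix is thus triangular with nonzero diagonal (`det_contentTrace_one_neg_one`).

This determinant need not be a unit, so it cannot be used over an arbitrary `R`. It does show that
the determinant over the domain of Laurent polynomials in two variables is nonzero, hence
independence there. Together with spanning this gives a basis over the generic ring. Its coordinate
functions are trace functions taking the values 0 and 1 on the `b_λ`, and they extend to any
specialization (`linearIndependent_partitionClass_baseChange`). The statement on traces follows
because trace functions are exactly the linear functions on `V`. -/

namespace IwahoriHecke

/-! ### Sequences satisfying the braid relations -/

/-- The first `N` terms of the sequence `s` satisfy the braid relations. -/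
structure IsBraidSeq {M : Type*} [Monoid M] (s : ℕ → M) (N : ℕ) : Prop where
  comm : ∀ i j, i + 1 < j → j < N → Commute (s i) (s j)
  braid : ∀ i, i + 1 < N → s i * s (i + 1) * s i = s (i + 1) * s i * s (i + 1)

section Monoid

variable {M M' : Type*} [Monoid M] [Monoid M']

/-- The product `s (k + j - 1) ⋯ s (k + 1) s k`. -/
def desc (s : ℕ → M) (k : ℕ) : ℕ → M
  | 0 => 1
  | j + 1 => s (k + j) * desc s k j

/-- The product `s k s (k + 1) ⋯ s (k + j - 1)`. -/
def asc (s : ℕ → M) (k : ℕ) : ℕ → M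
  | 0 => 1
  | j + 1 => asc s k j * s (k + j)

/-- The product of the descending products over consecutive blocks, of the sizes given by a list,
the first block starting at `k`. -/
def blocks (s : ℕ → M) : ℕ → List ℕ → M
  | _, [] => 1
  | k, m :: l => desc s k (m - 1) * blocks s (k + m) l

theorem map_desc (f : M →* M') (s : ℕ → M) (k j : ℕ) :
    f (desc s k j) = desc (fun i => f (s i)) k j := by
  induction j with
  | zero => simp [desc]
  | succ j ih => simp [desc, ih]

theorem map_blocks (f : M →* M') (s : ℕ → M) (k : ℕ) (l : List ℕ) :
    f (blocks s k l) = blocks (fun i => f (s i)) k l := by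
  induction l generalizing k with
  | nil => simp [blocks]
  | cons m l ih => simp [blocks, ih, map_desc]

theorem desc_succ (s : ℕ → M) (k j : ℕ) : desc s k (j + 1) = desc s (k + 1) j * s k := by
  induction j with
  | zero => simp [desc]
  | succ j ih =>
    rw [desc, ih, desc, mul_assoc]
    congr 2
    omega

theorem asc_succ (s : ℕ → M) (k j : ℕ) : asc s k (j + 1) = s k * asc s (k + 1) j := by
  induction j with
  | zero => simp [asc]
  | succ j ih =>
    rw [asc, ih, asc, mul_assoc]
    congr 3
    omega

theorem blocks_append_singleton (s : ℕ → M) (k : ℕ) (l : List ℕ) (m : ℕ) :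
    blocks s k (l ++ [m]) = blocks s k l * desc s (k + l.sum) (m - 1) := by
  induction l generalizing k with
  | nil => simp [blocks]
  | cons a l ih => simp [blocks, ih, mul_assoc, add_assoc]

theorem commute_desc {s : ℕ → M} {k j : ℕ} {x : M}
    (h : ∀ i, k ≤ i → i < k + j → Commute x (s i)) : Commute x (desc s k j) := by
  induction j with
  | zero => exact Commute.one_right x
  | succ j ih =>
    exact (h _ (by omega) (by omega)).mul_right (ih fun i h1 h2 => h i h1 (by omega))

theorem commute_asc {s : ℕ → M} {k j : ℕ} {x : M}
    (h : ∀ i, k ≤ i → i < k + j → Commute x (s i)) : Commute x (asc s k j) := by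
  induction j with
  | zero => exact Commute.one_right x
  | succ j ih =>
    exact (ih fun i h1 h2 => h i h1 (by omega)).mul_right (h _ (by omega) (by omega))

theorem commute_blocks {s : ℕ → M} {k : ℕ} {l : List ℕ} {x : M}
    (h : ∀ i, k ≤ i → i + 1 < k + l.sum → Commute x (s i)) : Commute x (blocks s k l) := by
  induction l generalizing k with
  | nil => exact Commute.one_right x
  | cons m l ih =>
    simp only [List.sum_cons] at h
    exact (commute_desc fun i h1 h2 => h i h1 (by omega)).mul_right
      (ih fun i h1 h2 => h i (by omega) (by omega))

theorem semiconjBy_desc {s : ℕ → M} {k k' j : ℕ} {x : M}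
    (h : ∀ i, i < j → SemiconjBy x (s (k + i)) (s (k' + i))) :
    SemiconjBy x (desc s k j) (desc s k' j) := by
  induction j with
  | zero => exact SemiconjBy.one_right x
  | succ j ih => exact (h _ (by omega)).mul_right (ih fun i h1 => h i (by omega))

namespace IsBraidSeq

variable {s : ℕ → M} {N : ℕ}

theorem map (hs : IsBraidSeq s N) (f : M →* M') : IsBraidSeq (fun i => f (s i)) N where
  comm i j h1 h2 := (hs.comm i j h1 h2).map f
  braid i h := by simpa using congrArg f (hs.braid i h)

/-- The ascending product acts like a rotation of the strands. Factors beyond `s (i + 1)` commute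
with `s i`; then one braid relation turns `s i` into `s (i + 1)`, which commutes with the remaining
factors. -/
theorem semiconjBy_asc (hs : IsBraidSeq s N) {k j i : ℕ} (hj : k + j ≤ N) (hk : k ≤ i)
    (hi : i + 1 < k + j) : SemiconjBy (asc s k j) (s i) (s (i + 1)) := by
  induction j with
  | zero => omega
  | succ j ih =>
    rcases Nat.lt_or_ge (i + 1) (k + j) with h | h
    · exact (ih (by omega) h).mul_left (hs.comm i (k + j) h (by omega)).symm
    · obtain ⟨j, rfl⟩ : ∃ j', j = j' + 1 := ⟨j - 1, by omega⟩
      obtain rfl : i = k + j := by omega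
      have hc : Commute (s (k + j + 1)) (asc s k j) :=
        commute_asc fun i' _ h2 => (hs.comm i' (k + j + 1) (by omega) (by omega)).symm
      have hb := hs.braid (k + j) (by omega)
      change asc s k j * s (k + j) * s (k + j + 1) * s (k + j) =
        s (k + j + 1) * (asc s k j * s (k + j) * s (k + j + 1))
      calc asc s k j * s (k + j) * s (k + j + 1) * s (k + j)
          = asc s k j * (s (k + j) * s (k + j + 1) * s (k + j)) := by simp only [mul_assoc]
        _ = asc s k j * s (k + j + 1) * (s (k + j) * s (k + j + 1)) := by
          rw [hb]; simp only [mul_assoc]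
        _ = s (k + j + 1) * (asc s k j * s (k + j) * s (k + j + 1)) := by
          rw [← hc.eq]; simp only [mul_assoc]

theorem semiconjBy_asc_pow (hs : IsBraidSeq s N) {k j i : ℕ} (r : ℕ) (hj : k + j ≤ N)
    (hk : k ≤ i) (hi : i + r < k + j) : SemiconjBy (asc s k j ^ r) (s i) (s (i + r)) := by
  induction r with
  | zero => simp
  | succ r ih =>
    rw [pow_succ']
    exact (hs.semiconjBy_asc (i := i + r) hj (by omega) (by omega)).mul_left (ih (by omega))

theorem semiconjBy_asc_asc (hs : IsBraidSeq s N) {k j m : ℕ} (hj : k + j ≤ N) (hm : m < j) :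
    SemiconjBy (asc s k j) (asc s k m) (asc s (k + 1) m) := by
  induction m with
  | zero => exact SemiconjBy.one_right _
  | succ m ih =>
    have := hs.semiconjBy_asc (i := k + m) hj (by omega) (by omega)
    rw [Nat.add_right_comm] at this
    exact (ih (by omega)).mul_right this

/-- The rotation has no generator to which it could send the last one in a single step, but its
square carries the last generator to the first. Shifting all but the last factor of the second copy
through the first copy exhibits this. -/
theorem semiconjBy_asc_sq (hs : IsBraidSeq s N) {k j : ℕ} (hj : k + (j + 1) ≤ N) :
    SemiconjBy (asc s k (j + 1) ^ 2) (s (k + j)) (s k) := by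
  have h := (hs.semiconjBy_asc_asc hj (Nat.lt_succ_self j)).eq
  have h2 : asc s k (j + 1) * asc s k (j + 1) =
      asc s (k + 1) j * asc s k (j + 1) * s (k + j) := by
    rw [← h, mul_assoc]
    rfl
  have h3 := asc_succ s k j
  unfold SemiconjBy
  rw [pow_two]
  conv_rhs => rw [h2, ← mul_assoc, ← mul_assoc, ← h3]

/-- A power of the ascending product moves the last block to the front. -/
theorem semiconjBy_asc_pow_wrap (hs : IsBraidSeq s N) {k a b i : ℕ} (ha : 0 < a)
    (hj : k + (a + b - 1) ≤ N) (hi : i + 1 < b) :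
    SemiconjBy (asc s k (a + b - 1) ^ b) (s (k + a + i)) (s (k + i)) := by
  -- The `b` rotations are used as follows: `b - 2 - i` bring the generator to the last place, 2
  -- wrap it around to the first, and `i` move it up to its target.
  have h1 := hs.semiconjBy_asc_pow (k := k) (i := k + a + i) (b - 2 - i) hj (by omega) (by omega)
  have e : k + a + i + (b - 2 - i) = k + (a + b - 2) := by omega
  have e' : a + b - 2 + 1 = a + b - 1 := by omega
  have h2 := hs.semiconjBy_asc_sq (k := k) (j := a + b - 2) (by omega)
  have h3 := hs.semiconjBy_asc_pow (k := k) (i := k) i hj le_rfl (by omega)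
  rw [e'] at h2
  rw [e] at h1
  have := h3.mul_left (h2.mul_left h1)
  rwa [← pow_add, ← pow_add, show i + (2 + (b - 2 - i)) = b by omega] at this

end IsBraidSeq

end Monoid

/-- Permuting the blocks conjugates the product, by an element that commutes with everything that
commutes with the terms of the sequence involved. -/
theorem IsBraidSeq.exists_semiconjBy_blocks {G : Type*} [Group G] {s : ℕ → G} {N : ℕ}
    (hs : IsBraidSeq s N) {l l' : List ℕ} (h : l.Perm l') (hpos : ∀ m ∈ l, 0 < m) (k : ℕ)
    (hk : k + l.sum ≤ N + 1) :
    ∃ g : G, (∀ x, (∀ i, k ≤ i → i + 1 < k + l.sum → Commute x (s i)) → Commute x g) ∧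
      SemiconjBy g (blocks s k l) (blocks s k l') := by
  induction h generalizing k with
  | nil => exact ⟨1, fun x _ => Commute.one_right x, SemiconjBy.one_left _⟩
  | @cons m l l' h ih =>
    simp only [List.sum_cons] at hk ⊢
    obtain ⟨g, hg, hg'⟩ := ih (fun m hm => hpos m (List.mem_cons_of_mem _ hm)) (k + m) (by omega)
    refine ⟨g, fun x hx => hg x fun i h1 h2 => hx i (by omega) (by omega), ?_⟩
    -- The clause on commuting elements is carried in the induction for this step: the first block
    -- commutes with the generators of the later ones, hence with the conjugating element.
    have : Commute (desc s k (m - 1)) g := hg _ fun i h1 h2 =>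
      (commute_desc fun i' h3 h4 => (hs.comm i' i (by omega) (by omega)).symm).symm
    exact SemiconjBy.mul_right this.symm hg'
  | swap a b l =>
    simp only [List.sum_cons] at hk ⊢
    have ha : 0 < a := hpos a (by simp)
    have hb : 0 < b := hpos b (by simp)
    -- Rotating the `b + a` strands by `a` places shifts the block of size `b` up by `a` and wraps
    -- the block of size `a` around to the front.
    refine ⟨asc s k (b + a - 1) ^ a, fun x hx => Commute.pow_right
      (commute_asc fun i h1 h2 => hx i h1 (by omega)) a, ?_⟩
    have h1 : SemiconjBy (asc s k (b + a - 1) ^ a) (desc s k (b - 1)) (desc s (k + a) (b - 1)) := by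
      refine semiconjBy_desc fun i hi => ?_
      have := hs.semiconjBy_asc_pow (k := k) (j := b + a - 1) (i := k + i) a (by omega) (by omega)
        (by omega)
      rwa [Nat.add_right_comm] at this
    have h2 : SemiconjBy (asc s k (b + a - 1) ^ a) (desc s (k + b) (a - 1)) (desc s k (a - 1)) :=
      semiconjBy_desc fun i hi => hs.semiconjBy_asc_pow_wrap hb (by omega) (by omega)
    have h3 : SemiconjBy (asc s k (b + a - 1) ^ a) (blocks s (k + b + a) l)
        (blocks s (k + a + b) l) := by
      rw [show k + b + a = k + a + b by omega]
      refine Commute.pow_left (commute_blocks fun i h4 h5 => ?_) a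
      exact (commute_asc fun i' h6 h7 => (hs.comm i' i (by omega) (by omega)).symm).symm
    have h4 : Commute (desc s k (a - 1)) (desc s (k + a) (b - 1)) :=
      commute_desc fun i h5 h6 =>
        (commute_desc fun i' h7 h8 => (hs.comm i' i (by omega) (by omega)).symm).symm
    have := (h1.mul_right h2).mul_right h3
    rw [← h4.eq] at this
    simpa only [blocks, mul_assoc] using this
  | @trans l₁ l₂ l₃ h12 h23 ih1 ih2 =>
    obtain ⟨g, hg, hg'⟩ := ih1 hpos k hk
    obtain ⟨g2, hg2, hg2'⟩ := ih2 (fun m hm => hpos m (h12.mem_iff.mpr hm)) k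
      (by rw [← h12.sum_eq]; exact hk)
    refine ⟨g2 * g, fun x hx => (hg2 x ?_).mul_right (hg x hx), hg2'.mul_left hg'⟩
    rwa [← h12.sum_eq]

/-! ### Spanning modulo commutators -/

section Spanning

variable {R H : Type*} [CommRing R] [Ring H] [Algebra R H]

/-- The subalgebra generated by the terms `t i` with `i + 1 < k`; for the generators of a Hecke
algebra, this is the subalgebra of the first `k` strands. -/
def strandAlg (R : Type*) {H : Type*} [CommRing R] [Ring H] [Algebra R H] (t : ℕ → H) (k : ℕ) :
    Subalgebra R H :=
  Algebra.adjoin R {x | ∃ i, i + 1 < k ∧ t i = x}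

/-- The span of the commutators with an element of a subalgebra. -/
def commSpan (S : Subalgebra R H) : Submodule R H :=
  Submodule.span R {x | ∃ a ∈ S, ∃ b, x = a * b - b * a}

theorem commSpan_mono {S S' : Subalgebra R H} (h : S ≤ S') : commSpan S ≤ commSpan S' :=
  Submodule.span_mono fun _ ⟨a, ha, b, hb⟩ => ⟨a, h ha, b, hb⟩

/-- `(a b - b a) c = a (b c) - (b c) a` when `c` commutes with `a`. This is why only one entry of
the commutators in `commSpan` is restricted to the subalgebra. -/
theorem mul_mem_commSpan {S : Subalgebra R H} {c x : H} (hc : ∀ a ∈ S, Commute a c)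
    (hx : x ∈ commSpan S) : x * c ∈ commSpan S := by
  induction hx using Submodule.span_induction with
  | mem x h =>
    obtain ⟨a, ha, b, rfl⟩ := h
    refine Submodule.subset_span ⟨a, ha, b * c, ?_⟩
    rw [sub_mul, mul_assoc b, (hc a ha).eq]
    simp only [mul_assoc]
  | zero => simp
  | add x y _ _ hx hy => rw [add_mul]; exact add_mem hx hy
  | smul r x _ hx => rw [smul_mul_assoc]; exact Submodule.smul_mem _ _ hx

theorem strandAlg_mono (t : ℕ → H) {k k' : ℕ} (h : k ≤ k') :
    strandAlg R t k ≤ strandAlg R t k' :=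
  Algebra.adjoin_mono fun _ ⟨i, hi, e⟩ => ⟨i, by omega, e⟩

theorem mem_strandAlg (t : ℕ → H) {i k : ℕ} (h : i + 1 < k) : t i ∈ strandAlg R t k :=
  Algebra.subset_adjoin ⟨i, h, rfl⟩

theorem strandAlg_commute {t : ℕ → H} {k : ℕ} {c : H} (h : ∀ i, i + 1 < k → Commute (t i) c)
    {a : H} (ha : a ∈ strandAlg R t k) : Commute a c := by
  induction ha using Algebra.adjoin_induction with
  | mem x hx => obtain ⟨i, hi, rfl⟩ := hx; exact h i hi
  | algebraMap r => exact Algebra.commutes r c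
  | add x y _ _ hx hy => exact hx.add_left hy
  | mul x y _ _ hx hy => exact hx.mul_left hy

theorem strandAlg_one_le (t : ℕ → H) {k : ℕ} (hk : k ≤ 1) {x : H} (hx : x ∈ strandAlg R t k) :
    ∃ r : R, x = algebraMap R H r := by
  have : {x | ∃ i, i + 1 < k ∧ t i = x} = (∅ : Set H) := by
    ext x
    simp only [Set.mem_ofPred_eq, Set.mem_empty_iff_false, iff_false]
    rintro ⟨i, hi, -⟩
    omega
  rw [strandAlg, this, Algebra.adjoin_empty, Algebra.mem_bot] at hx
  obtain ⟨r, rfl⟩ := hx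
  exact ⟨r, rfl⟩

/-- The span of the products `x t_k y` with `x` and `y` in the algebra of the first `k + 1`
strands, together with that algebra. -/
def bruhatSpan (R : Type*) {H : Type*} [CommRing R] [Ring H] [Algebra R H] (t : ℕ → H) (k : ℕ) :
    Submodule R H :=
  Subalgebra.toSubmodule (strandAlg R t (k + 1)) ⊔
    Submodule.span R {z | ∃ x ∈ strandAlg R t (k + 1), ∃ y ∈ strandAlg R t (k + 1), z = x * t k * y}

theorem mul_mem_bruhatSpan {t : ℕ → H} {k : ℕ} {a z : H} (ha : a ∈ strandAlg R t (k + 1))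
    (hz : z ∈ bruhatSpan R t k) : a * z ∈ bruhatSpan R t k := by
  obtain ⟨u, hu, v, hv, rfl⟩ := Submodule.mem_sup.mp hz
  rw [mul_add]
  refine add_mem (Submodule.mem_sup_left ((strandAlg R t (k + 1)).mul_mem ha hu)) (Submodule.mem_sup_right ?_)
  clear hz
  induction hv using Submodule.span_induction with
  | mem z h =>
    obtain ⟨x, hx, y, hy, rfl⟩ := h
    exact Submodule.subset_span ⟨a * x, mul_mem ha hx, y, hy, by simp only [mul_assoc]⟩
  | zero => simp
  | add x y _ _ hx hy => rw [mul_add]; exact add_mem hx hy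
  | smul r x _ hx => rw [mul_smul_comm]; exact Submodule.smul_mem _ _ hx

theorem mul_mem_bruhatSpan_right {t : ℕ → H} {k : ℕ} {a z : H} (ha : a ∈ strandAlg R t (k + 1))
    (hz : z ∈ bruhatSpan R t k) : z * a ∈ bruhatSpan R t k := by
  obtain ⟨u, hu, v, hv, rfl⟩ := Submodule.mem_sup.mp hz
  rw [add_mul]
  refine add_mem (Submodule.mem_sup_left ((strandAlg R t (k + 1)).mul_mem hu ha)) (Submodule.mem_sup_right ?_)
  clear hz
  induction hv using Submodule.span_induction with
  | mem z h =>
    obtain ⟨x, hx, y, hy, rfl⟩ := h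
    exact Submodule.subset_span ⟨x, hx, y * a, mul_mem hy ha, by simp only [mul_assoc]⟩
  | zero => simp
  | add x y _ _ hx hy => rw [add_mul]; exact add_mem hx hy
  | smul r x _ hx => rw [smul_mul_assoc]; exact Submodule.smul_mem _ _ hx

variable {t : ℕ → H} {N : ℕ} {α β : R}

/-- By the decomposition one level down, `x` is a sum of elements commuting with `t k`, where the
quadratic relation applies, and of products `x' t_{k-1} y'` with `x'` and `y'` commuting with `t k`,
where the braid relation replaces `t_k t_{k-1} t_k` by `t_{k-1} t_k t_{k-1}`. -/
theorem mul_mem_bruhatSpan_of_mem (ht : IsBraidSeq t N)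
    (hq : ∀ i < N, t i * t i = α • t i + β • (1 : H)) {k : ℕ} (hk : k < N)
    (ih : ∀ j, j + 1 = k → Subalgebra.toSubmodule (strandAlg R t (j + 2)) ≤ bruhatSpan R t j)
    {x : H} (hx : x ∈ strandAlg R t (k + 1)) : t k * x * t k ∈ bruhatSpan R t k := by
  have hmid : ∀ y ∈ strandAlg R t (k + 1), t k * y ∈ bruhatSpan R t k := fun y hy =>
    Submodule.mem_sup_right (Submodule.subset_span ⟨1, one_mem _, y, hy, by rw [one_mul]⟩)
  have hcomm : ∀ y ∈ strandAlg R t k, t k * y * t k ∈ bruhatSpan R t k := by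
    intro y hy
    have hc : Commute y (t k) := strandAlg_commute (fun i hi => ht.comm i k hi hk) hy
    have hy' : y ∈ strandAlg R t (k + 1) := strandAlg_mono t (Nat.le_succ k) hy
    rw [← hc.eq, mul_assoc, hq k hk]
    refine mul_mem_bruhatSpan hy' (add_mem (Submodule.smul_mem _ _ ?_) (Submodule.smul_mem _ _ ?_))
    · simpa using hmid 1 (one_mem _)
    · exact Submodule.mem_sup_left (one_mem (strandAlg R t (k + 1)))
  rcases k with _ | k
  · obtain ⟨r, rfl⟩ := strandAlg_one_le t le_rfl hx
    exact hcomm _ (algebraMap_mem _ r)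
  obtain ⟨u, hu, v, hv, rfl⟩ := Submodule.mem_sup.mp (ih k rfl hx)
  rw [mul_add, add_mul]
  refine add_mem (hcomm u hu) ?_
  clear hx
  induction hv using Submodule.span_induction with
  | mem z h =>
    obtain ⟨x, hx, y, hy, rfl⟩ := h
    have hcx : Commute x (t (k + 1)) := strandAlg_commute (fun i hi => ht.comm i _ hi hk) hx
    have hcy : Commute y (t (k + 1)) := strandAlg_commute (fun i hi => ht.comm i _ hi hk) hy
    have hx' := strandAlg_mono t (Nat.le_succ (k + 1)) hx
    have hy' := strandAlg_mono t (Nat.le_succ (k + 1)) hy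
    have htk : t k ∈ strandAlg R t (k + 1 + 1) := mem_strandAlg t (by omega)
    have e : t (k + 1) * (x * t k * y) * t (k + 1) =
        x * t k * (t (k + 1) * (t k * y)) := by
      calc t (k + 1) * (x * t k * y) * t (k + 1)
          = (t (k + 1) * x) * t k * (y * t (k + 1)) := by simp only [mul_assoc]
        _ = x * (t (k + 1) * t k * t (k + 1)) * y := by
          rw [hcy.eq, ← hcx.eq]; simp only [mul_assoc]
        _ = x * t k * (t (k + 1) * (t k * y)) := by
          rw [← ht.braid k hk]; simp only [mul_assoc]
    rw [e]
    exact mul_mem_bruhatSpan (mul_mem hx' htk) (hmid _ (mul_mem htk hy'))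
  | zero => simp
  | add x y _ _ hx hy => rw [mul_add, add_mul]; exact add_mem hx hy
  | smul r x _ hx => rw [mul_smul_comm, smul_mul_assoc]; exact Submodule.smul_mem _ _ hx

/-- The algebra of `k + 2` strands in terms of that of `k + 1` strands. -/
theorem strandAlg_le_bruhatSpan (ht : IsBraidSeq t N)
    (hq : ∀ i < N, t i * t i = α • t i + β • (1 : H)) (k : ℕ) (hk : k < N) :
    Subalgebra.toSubmodule (strandAlg R t (k + 2)) ≤ bruhatSpan R t k := by
  induction k using Nat.strong_induction_on with
  | _ k ih =>
    intro x hx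
    suffices h : ∀ z ∈ bruhatSpan R t k, x * z ∈ bruhatSpan R t k by
      simpa using h 1 (Submodule.mem_sup_left (one_mem (strandAlg R t (k + 1))))
    induction hx using Algebra.adjoin_induction with
    | mem x h =>
      obtain ⟨i, hi, rfl⟩ := h
      intro z hz
      rcases Nat.lt_or_ge (i + 1) (k + 1) with h | h
      · exact mul_mem_bruhatSpan (mem_strandAlg t h) hz
      obtain rfl : i = k := by omega
      obtain ⟨u, hu, v, hv, rfl⟩ := Submodule.mem_sup.mp hz
      rw [mul_add]
      refine add_mem (Submodule.mem_sup_right (Submodule.subset_span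
        ⟨1, one_mem _, u, hu, by rw [one_mul]⟩)) ?_
      clear hz
      induction hv using Submodule.span_induction with
      | mem z h =>
        obtain ⟨x, hx, y, hy, rfl⟩ := h
        rw [← mul_assoc, ← mul_assoc]
        refine mul_mem_bruhatSpan_right hy (mul_mem_bruhatSpan_of_mem ht hq hk
          (fun j hj => ih j (by omega) (by omega)) hx)
      | zero => simp
      | add x y _ _ hx hy => rw [mul_add]; exact add_mem hx hy
      | smul r x _ hx => rw [mul_smul_comm]; exact Submodule.smul_mem _ _ hx
    | algebraMap r => intro z hz; exact mul_mem_bruhatSpan (algebraMap_mem _ r) hz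
    | add x y _ _ hx hy => intro z hz; rw [add_mul]; exact add_mem (hx z hz) (hy z hz)
    | mul x y _ _ hx hy => intro z hz; rw [mul_assoc]; exact hx _ (hy z hz)

/-- The span of the products over the compositions of `n`, together with commutators. -/
def blockSpan (R : Type*) {H : Type*} [CommRing R] [Ring H] [Algebra R H] (t : ℕ → H) (n : ℕ) :
    Submodule R H :=
  commSpan (strandAlg R t n) ⊔
    Submodule.span R {x | ∃ l : List ℕ, (∀ m ∈ l, 0 < m) ∧ l.sum = n ∧ x = blocks t 0 l}

theorem mul_desc_mem_blockSpan (ht : IsBraidSeq t N) {k m : ℕ} (hm : 0 < m) (hk : k + m ≤ N + 1)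
    {x : H} (hx : x ∈ blockSpan R t k) : x * desc t k (m - 1) ∈ blockSpan R t (k + m) := by
  obtain ⟨u, hu, v, hv, rfl⟩ := Submodule.mem_sup.mp hx
  rw [add_mul]
  refine add_mem (Submodule.mem_sup_left (commSpan_mono (strandAlg_mono t (by omega))
    (mul_mem_commSpan (fun a ha => strandAlg_commute (fun i hi => commute_desc
      fun i' h1 h2 => ht.comm i i' (by omega) (by omega)) ha) hu))) (Submodule.mem_sup_right ?_)
  clear hx
  induction hv using Submodule.span_induction with
  | mem z h =>
    obtain ⟨l, hl, hs, rfl⟩ := h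
    refine Submodule.subset_span ⟨l ++ [m], ?_, by simp [hs], ?_⟩
    · intro m' hm'
      rcases List.mem_append.mp hm' with h | h
      · exact hl _ h
      · rw [List.mem_singleton.mp h]; exact hm
    · rw [blocks_append_singleton, hs, zero_add]
  | zero => simp
  | add x y _ _ hx hy => rw [add_mul]; exact add_mem hx hy
  | smul r x _ hx => rw [smul_mul_assoc]; exact Submodule.smul_mem _ _ hx

/-- Modulo commutators, the algebra of `n` strands is spanned by the products over the
compositions of `n`. -/
theorem strandAlg_le_blockSpan (ht : IsBraidSeq t N)
    (hq : ∀ i < N, t i * t i = α • t i + β • (1 : H)) (n : ℕ) (hn : n ≤ N + 1) :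
    Subalgebra.toSubmodule (strandAlg R t n) ≤ blockSpan R t n := by
  induction n using Nat.strong_induction_on with
  | _ n ih =>
  rcases Nat.eq_zero_or_pos n with rfl | hpos
  · intro x hx
    obtain ⟨r, rfl⟩ := strandAlg_one_le t (by omega) hx
    rw [Algebra.algebraMap_eq_smul_one]
    exact Submodule.smul_mem _ _ (Submodule.mem_sup_right (Submodule.subset_span
      ⟨[], by simp, rfl, rfl⟩))
  -- The prefix `t_{n-2} ⋯ t_k` grows as `k` decreases. At `k = n - 1` it is empty and the claim is
  -- the goal; at `k = 0` it is the full cycle and `x` is a scalar.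
  suffices h : ∀ k < n, ∀ x ∈ strandAlg R t (k + 1),
      desc t k (n - k - 1) * x ∈ blockSpan R t n by
    intro x hx
    have := h (n - 1) (by omega) x (by rwa [Nat.sub_add_cancel hpos])
    rwa [show n - (n - 1) - 1 = 0 by omega, desc, one_mul] at this
  intro k
  induction k with
  | zero =>
    intro _ x hx
    obtain ⟨r, rfl⟩ := strandAlg_one_le t (by omega) hx
    rw [← Algebra.commutes, ← Algebra.smul_def]
    exact Submodule.smul_mem _ _ (Submodule.mem_sup_right (Submodule.subset_span
      ⟨[n], by simpa using hpos, by simp, by simp [blocks]⟩))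
  | succ k ihk =>
    intro hk x hx
    have hcd : ∀ a ∈ strandAlg R t (k + 1), Commute a (desc t (k + 1) (n - (k + 1) - 1)) :=
      fun a ha => strandAlg_commute (fun i hi => commute_desc
        fun i' h1 h2 => ht.comm i i' (by omega) (by omega)) ha
    obtain ⟨u, hu, v, hv, rfl⟩ := Submodule.mem_sup.mp
      (strandAlg_le_bruhatSpan ht hq k (by omega) hx)
    rw [mul_add]
    refine add_mem ?_ ?_
    -- Here `t k` is absent, so the prefix is a separate last block of `n - (k + 1)` strands, and
    -- the induction on the number of strands applies to `u`.
    · rw [← (hcd u hu).eq]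
      have := mul_desc_mem_blockSpan ht (m := n - (k + 1)) (by omega) (by omega)
        (ih (k + 1) hk (by omega) hu)
      rwa [show k + 1 + (n - (k + 1)) = n by omega] at this
    · clear hx
      induction hv using Submodule.span_induction with
      | mem z h =>
        obtain ⟨x, hx, y, hy, rfl⟩ := h
        -- The factor `x` commutes with the prefix, so it can be moved to the far left and then,
        -- modulo a commutator, to the far right. The factor `t k` lengthens the prefix, and `y * x`
        -- involves one strand fewer.
        have e : desc t (k + 1) (n - (k + 1) - 1) * (x * t k * y) =
            (x * (desc t k (n - k - 1) * y) - (desc t k (n - k - 1) * y) * x) +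
              desc t k (n - k - 1) * (y * x) := by
          rw [show n - k - 1 = n - (k + 1) - 1 + 1 by omega, desc_succ]
          calc _ = (desc t (k + 1) (n - (k + 1) - 1) * x) * t k * y := by simp only [mul_assoc]
            _ = x * desc t (k + 1) (n - (k + 1) - 1) * t k * y := by rw [(hcd x hx).eq]
            _ = _ := by simp only [mul_assoc, sub_add_cancel]
        rw [e]
        exact add_mem (Submodule.mem_sup_left (Submodule.subset_span
          ⟨x, strandAlg_mono t (by omega) hx, _, rfl⟩)) (ihk (by omega) _ (mul_mem hy hx))
      | zero => simp
      | add x y _ _ hx hy => rw [mul_add]; exact add_mem hx hy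
      | smul r x _ hx => rw [mul_smul_comm]; exact Submodule.smul_mem _ _ hx

end Spanning

/-! ### The action of the Hecke algebra on words -/

section Words

open Equiv

variable {R : Type*} [CommRing R] {ι α : Type*} [DecidableEq ι] [LinearOrder α]

/-- The `R`-matrix operator, with eigenvalues `q₁` and `q₂`, on the functions of words, acting on
the positions `a` and `b`. -/
def wordOp (q₁ q₂ : R) (a b : ι) : Module.End R ((ι → α) → R) where
  toFun f w :=
    if w a = w b then q₁ * f w
    else if w a < w b then f (w ∘ swap a b)
    else (q₁ + q₂) * f w - q₁ * q₂ * f (w ∘ swap a b)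
  map_add' f g := by
    ext w
    simp only [Pi.add_apply]
    split_ifs <;> ring
  map_smul' c f := by
    ext w
    simp only [Pi.smul_apply, smul_eq_mul, RingHom.id_apply]
    split_ifs <;> ring

theorem wordOp_apply (q₁ q₂ : R) (a b : ι) (f : (ι → α) → R) (w : ι → α) :
    wordOp q₁ q₂ a b f w =
      if w a = w b then q₁ * f w
      else if w a < w b then f (w ∘ swap a b)
      else (q₁ + q₂) * f w - q₁ * q₂ * f (w ∘ swap a b) := rfl

omit [LinearOrder α] in
theorem comp_swap_comp_swap (w : ι → α) (a b : ι) : (w ∘ swap a b) ∘ swap a b = w := by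
  ext x
  simp

/-- On the two words that differ by exchanging distinct letters at `a` and `b`, the operator is the
companion matrix of `(x - q₁)(x - q₂)`; on a word with equal letters there it is the scalar `q₁`. -/
theorem wordOp_quad (q₁ q₂ : R) (a b : ι) :
    (wordOp q₁ q₂ a b - algebraMap R (Module.End R ((ι → α) → R)) q₁) *
      (wordOp q₁ q₂ a b - algebraMap R _ q₂) = 0 := by
  ext f w
  simp only [Module.End.mul_apply, LinearMap.sub_apply, Module.algebraMap_end_apply, Pi.sub_apply,
    wordOp_apply, Pi.smul_apply, smul_eq_mul, LinearMap.zero_apply, Pi.zero_apply, map_sub,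
    Function.comp_apply, swap_apply_left, swap_apply_right, comp_swap_comp_swap]
  rcases lt_trichotomy (w a) (w b) with h | h | h
  · simp only [h, h.ne, h.ne', h.not_gt, if_true, if_false]
    ring
  · simp only [h, if_true]
    ring
  · simp only [h, h.ne, h.ne', h.not_gt, if_true, if_false]
    ring

theorem wordOp_comm (q₁ q₂ : R) {a b c d : ι} (hac : a ≠ c) (had : a ≠ d) (hbc : b ≠ c)
    (hbd : b ≠ d) :
    Commute (wordOp q₁ q₂ a b : Module.End R ((ι → α) → R)) (wordOp q₁ q₂ c d) := by
  have hs : ∀ w : ι → α, (w ∘ swap a b) ∘ swap c d = (w ∘ swap c d) ∘ swap a b := by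
    intro w
    have : swap a b * swap c d = swap c d * swap a b := by
      ext x
      simp only [Perm.mul_apply, swap_apply_def]
      split_ifs <;> simp_all
    have h2 := congrArg (fun p : Perm ι => w ∘ p) this
    simpa only [Perm.coe_mul, Function.comp_assoc] using h2
  refine LinearMap.ext fun f => funext fun w => ?_
  simp only [Module.End.mul_apply, wordOp_apply, Function.comp_apply,
    swap_apply_of_ne_of_ne hac had, swap_apply_of_ne_of_ne hbc hbd,
    swap_apply_of_ne_of_ne hac.symm hbc.symm, swap_apply_of_ne_of_ne had.symm hbd.symm, hs]
  split_ifs <;> ring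

/-- Only the relative order of the letters at the three positions matters. Each consistent order
type gives a polynomial identity, once the two expressions for the transposition of `a` and `c` are
identified. -/
theorem wordOp_braid (q₁ q₂ : R) {a b c : ι} (hab : a ≠ b) (hbc : b ≠ c) (hac : a ≠ c) :
    (wordOp q₁ q₂ a b : Module.End R ((ι → α) → R)) * wordOp q₁ q₂ b c * wordOp q₁ q₂ a b =
      wordOp q₁ q₂ b c * wordOp q₁ q₂ a b * wordOp q₁ q₂ b c := by
  have hs : ∀ w : ι → α, ((w ∘ swap a b) ∘ swap b c) ∘ swap a b =
      ((w ∘ swap b c) ∘ swap a b) ∘ swap b c := by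
    intro w
    have : swap a b * swap b c * swap a b = swap b c * swap a b * swap b c := by
      rw [swap_mul_swap_mul_swap hab hac, swap_comm a b, swap_comm b c,
        swap_mul_swap_mul_swap hbc.symm hac.symm, swap_comm]
    have h2 := congrArg (fun p : Perm ι => w ∘ p) this
    simpa only [Perm.coe_mul, Function.comp_assoc] using h2
  refine LinearMap.ext fun f => funext fun w => ?_
  simp only [Module.End.mul_apply, wordOp_apply, Function.comp_apply, swap_apply_left,
    swap_apply_right, swap_apply_of_ne_of_ne hab hac, swap_apply_of_ne_of_ne hac.symm hbc.symm,
    comp_swap_comp_swap, hs]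
  rcases lt_trichotomy (w a) (w b) with h1 | h1 | h1 <;>
  rcases lt_trichotomy (w b) (w c) with h2 | h2 | h2 <;>
  rcases lt_trichotomy (w a) (w c) with h3 | h3 | h3 <;>
  first
    | (exfalso; order)
    | (simp only [h1, h2, h3, h1.ne, h1.ne', h1.not_gt, h2.ne, h2.ne', h2.not_gt,
        h3.ne, h3.ne', h3.not_gt, if_true, if_false] <;> ring1)
    | (simp only [h3, h2, h2.ne, h2.ne', h2.not_gt, if_true, if_false] <;> ring1)
    | (simp only [h1, h2, h2.ne, h2.ne', h2.not_gt, if_true, if_false] <;> ring1)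
    | (simp only [h2, h3, h3.ne, h3.ne', h3.not_gt, if_true, if_false] <;> ring1)
    | simp only [h1, h2, if_true]

end Words

/-! ### Words fixed by a product of cycles on consecutive blocks -/

section Blocks

theorem desc_mem {M : Type*} [Monoid M] {s : ℕ → M} {S : Submonoid M} {k j : ℕ}
    (h : ∀ i, k ≤ i → i < k + j → s i ∈ S) : desc s k j ∈ S := by
  induction j with
  | zero => exact S.one_mem
  | succ j ih =>
    exact S.mul_mem (h _ (by omega) (by omega)) (ih fun i h1 h2 => h i h1 (by omega))

theorem blocks_mem {M : Type*} [Monoid M] {s : ℕ → M} {S : Submonoid M} {k : ℕ} {l : List ℕ}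
    (h : ∀ i, k ≤ i → i + 1 < k + l.sum → s i ∈ S) : blocks s k l ∈ S := by
  induction l generalizing k with
  | nil => exact S.one_mem
  | cons m l ih =>
    simp only [List.sum_cons] at h
    exact S.mul_mem (desc_mem fun i h1 h2 => h i h1 (by omega))
      (ih fun i h1 h2 => h i (by omega) (by omega))

/-- The index of the block containing `x`, for consecutive blocks of the sizes in the list. -/
def blockIdx : List ℕ → ℕ → ℕ
  | [], _ => 0
  | m :: l, x => if x < m then 0 else blockIdx l (x - m) + 1

theorem card_filter_blockIdx (l : List ℕ) (i : ℕ) :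
    ((Finset.range l.sum).filter fun x => blockIdx l x = i).card = l.getD i 0 := by
  induction l generalizing i with
  | nil => simp
  | cons m l ih =>
    have h1 : ∀ x ∈ Finset.range m, (if blockIdx (m :: l) x = i then 1 else 0) =
        if i = 0 then 1 else 0 := by
      intro x hx
      simp [blockIdx, Finset.mem_range.mp hx, eq_comm]
    rw [Finset.card_filter, List.sum_cons, Finset.sum_range_add, Finset.sum_congr rfl h1]
    rcases i with _ | i
    · simp [blockIdx]
    · have := ih i
      rw [Finset.card_filter] at this
      simpa [blockIdx] using this

/-- The multiset of the multiplicities of the letters of a word. -/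
def content {ι α : Type*} [Fintype ι] [DecidableEq α] (w : ι → α) : Multiset ℕ :=
  (Finset.univ.image w).val.map fun a => (Finset.univ.filter fun x => w x = a).card

theorem card_content {ι α : Type*} [Fintype ι] [DecidableEq α] (w : ι → α) :
    (content w).card = (Finset.univ.image w).card := by
  rw [content, Multiset.card_map, Finset.card_val]

theorem content_comp {ι α β : Type*} [Fintype ι] [DecidableEq α] [DecidableEq β] (w : ι → α)
    (g : α → β) (hg : Set.InjOn g (Finset.univ.image w : Finset α)) :
    content (g ∘ w) = content w := by
  unfold content
  rw [← Finset.image_image, Finset.image_val_of_injOn hg, Multiset.map_map]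
  refine Multiset.map_congr rfl fun a ha => ?_
  simp only [Function.comp_apply]
  congr 1
  ext x
  simp only [Finset.mem_filter, Finset.mem_univ, true_and]
  exact ⟨fun h => hg (by simp) ha h, fun h => by rw [h]⟩

theorem content_perm {ι α : Type*} [Fintype ι] [DecidableEq α] (w : ι → α) (p : Equiv.Perm ι) :
    content (w ∘ p) = content w := by
  have h1 : Finset.univ.image (w ∘ p) = Finset.univ.image w := by
    ext a
    simp only [Finset.mem_image, Finset.mem_univ, true_and, Function.comp_apply]
    exact (p.surjective.exists (p := fun x => w x = a)).symm
  unfold content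
  rw [h1]
  refine Multiset.map_congr rfl fun a _ => ?_
  exact Finset.card_bij (fun x _ => p x) (by simp) (by simp)
    fun x hx => ⟨p.symm x, by simpa using hx, by simp⟩

theorem blockIdx_le {l : List ℕ} (hl : ∀ m ∈ l, 0 < m) (x : ℕ) : blockIdx l x ≤ x := by
  induction l generalizing x with
  | nil => exact Nat.zero_le _
  | cons m l ih =>
    have h1 := hl m (by simp)
    have h2 := ih (fun m hm => hl m (List.mem_cons_of_mem _ hm)) (x - m)
    rw [blockIdx]
    split_ifs <;> omega

theorem content_blockIdx {n : ℕ} {l : List ℕ} (hl : ∀ m ∈ l, 0 < m) (hn : l.sum = n) :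
    content (fun x : Fin n => blockIdx l x) = l := by
  subst hn
  have hc : ∀ i, (Finset.univ.filter fun x : Fin l.sum => blockIdx l x = i).card =
      l.getD i 0 := by
    intro i
    rw [← card_filter_blockIdx, Finset.card_filter, Finset.card_filter, ← Fin.sum_univ_eq_sum_range
      (fun x => if blockIdx l x = i then 1 else 0)]
  have hi : Finset.univ.image (fun x : Fin l.sum => blockIdx l x) = Finset.range l.length := by
    ext i
    have : i ∈ Finset.univ.image (fun x : Fin l.sum => blockIdx l x) ↔
        0 < (Finset.univ.filter fun x : Fin l.sum => blockIdx l x = i).card := by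
      rw [Finset.card_pos]
      simp [Finset.Nonempty]
    rw [this, hc, Finset.mem_range]
    rcases Nat.lt_or_ge i l.length with h | h
    · rw [List.getD_eq_getElem _ _ h]
      simp [h, hl _ (List.getElem_mem h)]
    · rw [List.getD_eq_default _ _ h]
      simp [h]
  unfold content
  rw [hi]
  simp only [hc]
  rw [Finset.range_val, Multiset.range, Multiset.map_coe]
  congr 1
  refine List.ext_getElem (by simp) fun i h1 h2 => ?_
  simp [List.getElem?_eq_getElem h2]

/-- The transposition of the positions `i` and `i + 1`. -/
def adjSwap (n i : ℕ) : Equiv.Perm (Fin n) :=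
  if h : i + 1 < n then Equiv.swap ⟨i, by omega⟩ ⟨i + 1, h⟩ else 1

variable {n : ℕ}

theorem adjSwap_apply_of_ne {i : ℕ} {x : Fin n} (h1 : x.1 ≠ i) (h2 : x.1 ≠ i + 1) :
    adjSwap n i x = x := by
  unfold adjSwap
  split_ifs with h
  · exact Equiv.swap_apply_of_ne_of_ne (fun e => h1 (by rw [e])) fun e => h2 (by rw [e])
  · rfl

theorem adjSwap_apply_succ {i : ℕ} (h : i + 1 < n) :
    adjSwap n i ⟨i + 1, h⟩ = ⟨i, by omega⟩ := by
  rw [adjSwap, dif_pos h, Equiv.swap_apply_right]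

/-- The permutations fixing a point, as a submonoid. -/
def fixing {X : Type*} (x : X) : Submonoid (Equiv.Perm X) where
  carrier := {p | p x = x}
  one_mem' := rfl
  mul_mem' {p q} hp hq := by
    change p (q x) = x
    rw [hq, hp]

/-- The permutations preserving a function, as a submonoid. -/
def preserving {X Y : Type*} (w : X → Y) : Submonoid (Equiv.Perm X) where
  carrier := {p | ∀ x, w (p x) = w x}
  one_mem' _ := rfl
  mul_mem' {p q} hp hq x := by
    change w (p (q x)) = w x
    rw [hp, hq]

theorem desc_adjSwap_apply_of_lt {k j : ℕ} {x : Fin n} (h : k + j < x.1) :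
    desc (adjSwap n) k j x = x :=
  desc_mem (S := fixing x) fun i _ h2 => adjSwap_apply_of_ne (by omega) (by omega)

theorem blocks_adjSwap_apply_of_lt {k : ℕ} {l : List ℕ} {x : Fin n} (h : x.1 < k) :
    blocks (adjSwap n) k l x = x :=
  blocks_mem (S := fixing x) fun i _ h2 => adjSwap_apply_of_ne (by omega) (by omega)

theorem desc_adjSwap_apply {k j x : ℕ} (hx : x + 1 < n) (hk : k ≤ x) (hj : x < k + j) :
    desc (adjSwap n) k j ⟨x + 1, hx⟩ = ⟨x, by omega⟩ := by
  induction j with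
  | zero => omega
  | succ j ih =>
    rw [desc, Equiv.Perm.mul_apply]
    rcases Nat.lt_or_ge x (k + j) with h | h
    · rw [ih h]
      exact adjSwap_apply_of_ne (by simp only; omega) (by simp only; omega)
    · obtain rfl : x = k + j := by omega
      rw [desc_adjSwap_apply_of_lt (by simp), adjSwap_apply_succ]

/-- Each block of the permutation is a single cycle, so a word it preserves is constant on blocks.
The cycle on the first block sends `z + 1` to `z`, which links all its positions to the first one;
the later blocks are handled by induction. -/
theorem eq_of_blocks_mem_preserving {α : Type*} {w : Fin n → α} {k : ℕ} {l : List ℕ}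
    (h : blocks (adjSwap n) k l ∈ preserving w) {x y : ℕ} (hkx : k ≤ x) (hky : k ≤ y)
    (hx : x < k + l.sum) (hy : y < k + l.sum) (hxn : x < n) (hyn : y < n)
    (e : blockIdx l (x - k) = blockIdx l (y - k)) : w ⟨x, hxn⟩ = w ⟨y, hyn⟩ := by
  induction l generalizing k with
  | nil => simp at hx; omega
  | cons m l ih =>
    simp only [List.sum_cons] at hx hy
    have hlow : ∀ z : Fin n, z.1 < k + m → w (desc (adjSwap n) k (m - 1) z) = w z := by
      intro z hz
      have h2 := h z
      rwa [blocks, Equiv.Perm.mul_apply, blocks_adjSwap_apply_of_lt hz] at h2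
    have hhigh : blocks (adjSwap n) (k + m) l ∈ preserving w := by
      intro z
      rcases Nat.lt_or_ge z.1 (k + m) with hz | hz
      · rw [blocks_adjSwap_apply_of_lt hz]
      · have h2 := h z
        rw [blocks, Equiv.Perm.mul_apply] at h2
        rcases Nat.lt_or_ge (blocks (adjSwap n) (k + m) l z).1 (k + m) with h3 | h3
        -- The later blocks fix this image, so by injectivity it is `z` itself.
        · have h4 := blocks_adjSwap_apply_of_lt (l := l) h3
          rw [(blocks (adjSwap n) (k + m) l).injective h4]
        -- For `m = 0` the truncated `m - 1` is 0, and the first block is the identity.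
        · rcases Nat.eq_zero_or_pos m with rfl | hm
          · exact h2
          · rwa [desc_adjSwap_apply_of_lt (by omega)] at h2
    have hfirst : ∀ z, k ≤ z → z < k + m → ∀ hz : z < n, ∀ hk : k < n, w ⟨z, hz⟩ = w ⟨k, hk⟩ := by
      intro z hkz
      induction z, hkz using Nat.le_induction with
      | base => intros; rfl
      | succ z hkz ihz =>
        intro h1 h2 h3
        rw [← ihz (by omega) (by omega) h3, ← hlow ⟨z + 1, h2⟩ h1,
          desc_adjSwap_apply h2 hkz (by omega)]
    simp only [blockIdx] at e
    split_ifs at e with h1 h2 h2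
    · rw [hfirst x hkx (by omega) hxn (by omega), hfirst y hky (by omega) hyn (by omega)]
    · refine ih hhigh (by omega) (by omega) (by omega) (by omega) ?_
      rw [← Nat.sub_sub, ← Nat.sub_sub]
      omega

theorem blocks_mem_preserving {α : Type*} {w : Fin n → α} {k : ℕ} {l : List ℕ}
    (hw : ∀ x y : Fin n, k ≤ x.1 → k ≤ y.1 → blockIdx l (x - k) = blockIdx l (y - k) → w x = w y) :
    blocks (adjSwap n) k l ∈ preserving w := by
  induction l generalizing k with
  | nil => exact Submonoid.one_mem _
  | cons m l ih =>
    refine Submonoid.mul_mem _ (desc_mem fun i h1 h2 => ?_) (ih fun x y hx hy e => ?_)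
    · intro x
      unfold adjSwap
      split_ifs with h
      · have := hw ⟨i, by omega⟩ ⟨i + 1, h⟩ h1 (by simp only; omega) (by
          simp only [blockIdx]
          rw [if_pos (by omega), if_pos (by omega)])
        rw [Equiv.swap_apply_def]
        split_ifs with h3 h3
        · rw [h3, this]
        · rw [h3, this]
        · rfl
      · rfl
    · refine hw x y (by omega) (by omega) ?_
      simp only [blockIdx]
      rw [if_neg (by omega), if_neg (by omega), Nat.sub_sub, Nat.sub_sub, e]

/-- The content of a word fixed by a product of cycles has at most as many parts as there are
cycles, and if it has as many parts, they are the lengths of the cycles. -/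
theorem content_of_blocks_mem_preserving {α : Type*} [DecidableEq α] [Nonempty α] {w : Fin n → α}
    {l : List ℕ} (hl : ∀ m ∈ l, 0 < m) (hn : l.sum = n)
    (h : blocks (adjSwap n) 0 l ∈ preserving w) :
    (content w).card ≤ l.length ∧ ((content w).card = l.length → content w = l) := by
  -- The word is a relabelling of the block indices. A relabelling cannot increase the number of
  -- letters, and if it preserves that number it is injective on them and preserves the content.
  have hf : Function.FactorsThrough w (fun x : Fin n => blockIdx l x) := by
    intro x y e
    exact eq_of_blocks_mem_preserving h (Nat.zero_le _) (Nat.zero_le _) (by omega) (by omega)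
      x.2 y.2 (by simpa using e)
  obtain ⟨g, rfl⟩ := (Function.factorsThrough_iff _).mp hf
  have hb := content_blockIdx hl hn
  have hlen := congrArg Multiset.card hb
  rw [card_content, Multiset.coe_card] at hlen
  rw [card_content, ← Finset.image_image, ← hlen]
  refine ⟨Finset.card_image_le, fun e => ?_⟩
  rw [content_comp _ _ (Finset.card_image_iff.mp e), hb]

/-- The word of block indices works. Positivity of the parts keeps each index at most the position,
so `n` letters are enough. -/
theorem exists_content_eq {l : List ℕ} (hl : ∀ m ∈ l, 0 < m) (hn : l.sum = n) :
    ∃ w : Fin n → Fin n, content w = l ∧ blocks (adjSwap n) 0 l ∈ preserving w := by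
  refine ⟨fun x => ⟨blockIdx l x, (blockIdx_le hl _).trans_lt x.2⟩, ?_,
    blocks_mem_preserving fun x y _ _ e => ?_⟩
  · rw [← content_blockIdx hl hn, ← content_comp _ Fin.val Fin.val_injective.injOn]
    rfl
  · simp only [Nat.sub_zero] at e
    simp [e]

end Blocks

/-! ### The generators as sequences -/

section Sequences

/-- The generators of the braid group as a sequence starting with `σ_1`, continued by `1`. -/
def sigmaSeq (n i : ℕ) : BraidGroup n :=
  if h : i + 1 < n then sigma ⟨i + 1, by omega⟩ else 1

theorem sigmaSeq_of_lt {n i : ℕ} (h : i + 1 < n) :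
    sigmaSeq n i = sigma ⟨i + 1, by omega⟩ := dif_pos h

theorem BraidGroup.lift_sigma {n : ℕ} {G : Type*} [Group G] (f : Gen n → G)
    (hc : ∀ i j : Gen n, 1 < |(i.1 : ℤ) - (j.1 : ℤ)| → f i * f j = f j * f i)
    (hb : ∀ i j : Gen n, |(i.1 : ℤ) - (j.1 : ℤ)| = 1 → f i * f j * f i = f j * f i * f j)
    (i : Gen n) : BraidGroup.lift f hc hb (sigma i) = f i := by
  unfold BraidGroup.lift sigma
  exact PresentedGroup.toGroup.of _

theorem isBraidSeq_sigmaSeq (n : ℕ) : IsBraidSeq (sigmaSeq n) (n - 1) where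
  comm i j hij hj := by
    rw [sigmaSeq_of_lt (by omega), sigmaSeq_of_lt (by omega)]
    refine sigma_comm _ _ ?_
    rw [abs_sub_comm, lt_abs]
    left
    push_cast
    omega
  braid i hi := by
    rw [sigmaSeq_of_lt (by omega), sigmaSeq_of_lt (by omega)]
    refine sigma_braid _ _ ?_
    push_cast
    norm_num

theorem desc_eq_prod {M : Type*} [Monoid M] (s : ℕ → M) (k j : ℕ) :
    desc s k j = (List.ofFn fun x : Fin j => s (k + (j - 1 - x.1))).prod := by
  induction j with
  | zero => simp [desc]
  | succ j ih =>
    rw [List.ofFn_succ, List.prod_cons, desc, ih]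
    congr 3
    ext x
    congr 2
    simp only [Fin.val_succ]
    omega

theorem place_cycleBraid {m n : ℕ} (k : ℕ) (h : k + m ≤ n) :
    place k h (cycleBraid m) = desc (sigmaSeq n) k (m - 1) := by
  rw [desc_eq_prod, cycleBraid, map_list_prod, List.map_ofFn]
  congr 2
  funext x
  have hx := x.2
  rw [sigmaSeq_of_lt (by omega), Function.comp_apply, place, BraidGroup.lift_sigma]
  congr 2
  simp only
  omega

theorem disjointCycles_eq_blocks {n : ℕ} (k : ℕ) (l : List ℕ) (h : k + l.sum ≤ n) :
    disjointCycles n k l h = blocks (sigmaSeq n) k l := by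
  induction l generalizing k with
  | nil => rfl
  | cons m l ih => rw [disjointCycles, blocks, place_cycleBraid, ih]

theorem partitionBraid_eq_blocks {n : ℕ} (p : n.Partition) :
    partitionBraid p = blocks (sigmaSeq n) 0 (partList p) :=
  disjointCycles_eq_blocks _ _ _

theorem coe_partList {n : ℕ} (p : n.Partition) : (partList p : Multiset ℕ) = p.parts :=
  Multiset.sort_eq _ _

theorem partList_pos {n : ℕ} (p : n.Partition) : ∀ m ∈ partList p, 0 < m := fun m hm =>
  p.parts_pos (by rwa [← coe_partList p, Multiset.mem_coe])

variable {R : Type*} [CommRing R] (n : ℕ) (q₁ q₂ : Rˣ)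

/-- The generators of the Hecke algebra as a sequence starting with `T_1`, continued by `1`. -/
def heckeSeq (i : ℕ) : HeckeAlgebra n q₁ q₂ :=
  (braidToHecke q₁ q₂ (sigmaSeq n i)).1

variable {n}

theorem braidToHecke_sigma (i : Gen n) : (braidToHecke q₁ q₂ (sigma i)).1 = T q₁ q₂ i :=
  congrArg Units.val (BraidGroup.lift_sigma _ _ _ i)

theorem heckeSeq_of_lt {i : ℕ} (h : i + 1 < n) :
    heckeSeq n q₁ q₂ i = T q₁ q₂ ⟨i + 1, by omega⟩ := by
  rw [heckeSeq, sigmaSeq_of_lt h, braidToHecke_sigma]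

theorem heckeSeq_of_ge {i : ℕ} (h : n ≤ i + 1) : heckeSeq n q₁ q₂ i = 1 := by
  rw [heckeSeq, sigmaSeq, dif_neg (by omega), map_one, Units.val_one]

theorem braidToHecke_blocks (k : ℕ) (l : List ℕ) :
    (braidToHecke q₁ q₂ (blocks (sigmaSeq n) k l)).1 = blocks (heckeSeq n q₁ q₂) k l :=
  map_blocks ((Units.coeHom _).comp (braidToHecke q₁ q₂)) _ _ _

variable (n)

theorem isBraidSeq_heckeSeq : IsBraidSeq (heckeSeq n q₁ q₂) (n - 1) :=
  (isBraidSeq_sigmaSeq n).map ((Units.coeHom _).comp (braidToHecke q₁ q₂))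

theorem mul_self_eq_of_quadratic {H : Type*} [Ring H] [Algebra R H] {a b : R} {t : H}
    (h : (t - algebraMap R H a) * (t - algebraMap R H b) = 0) :
    t * t = (a + b) • t + (-(a * b)) • (1 : H) := by
  rw [sub_mul, mul_sub, mul_sub, ← Algebra.commutes b t, ← map_mul, ← Algebra.smul_def,
    ← Algebra.smul_def, Algebra.algebraMap_eq_smul_one] at h
  rw [← sub_eq_zero, ← h, add_smul, neg_smul]
  abel

theorem heckeSeq_mul_self {i : ℕ} (h : i < n - 1) :
    heckeSeq n q₁ q₂ i * heckeSeq n q₁ q₂ i =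
      ((q₁ : R) + q₂) • heckeSeq n q₁ q₂ i + (-((q₁ : R) * q₂)) • 1 := by
  have hq := T_quad q₁ q₂ (⟨i + 1, by omega⟩ : Gen n)
  rw [← heckeSeq_of_lt q₁ q₂ (by omega)] at hq
  exact mul_self_eq_of_quadratic hq

theorem strandAlg_heckeSeq : strandAlg R (heckeSeq n q₁ q₂) n = ⊤ := by
  rw [eq_top_iff]
  have h : (⊤ : Subalgebra R (HeckeAlgebra n q₁ q₂)) =
      Subalgebra.map (RingQuot.mkAlgHom R (HeckeRel n q₁ q₂)) ⊤ := by
    rw [Algebra.map_top, eq_comm, AlgHom.range_eq_top]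
    exact RingQuot.mkAlgHom_surjective R _
  rw [h, ← FreeAlgebra.adjoin_range_ι, AlgHom.map_adjoin]
  refine Algebra.adjoin_mono ?_
  rintro _ ⟨_, ⟨⟨i, hi⟩, rfl⟩, rfl⟩
  refine ⟨i - 1, by omega, ?_⟩
  rw [heckeSeq_of_lt _ _ (by omega)]
  change T q₁ q₂ _ = T q₁ q₂ _
  congr 2
  omega

variable {n}

/-- The class in `V` of the braid `b_λ`. -/
def partitionClass (p : n.Partition) : V n q₁ q₂ :=
  closedBraidClass q₁ q₂ (partitionClosedBraid p)

theorem partitionClass_eq (p : n.Partition) : partitionClass q₁ q₂ p =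
    (commutatorSpan n q₁ q₂).mkQ (braidToHecke q₁ q₂ (partitionBraid p)).1 := rfl

/-- Sorting the composition into a partition conjugates the braid, and conjugate braids have the
same class in `V`. -/
theorem mkQ_blocks_mem {l : List ℕ} (hl : ∀ m ∈ l, 0 < m) (hn : l.sum = n) :
    (commutatorSpan n q₁ q₂).mkQ (blocks (heckeSeq n q₁ q₂) 0 l) ∈
      Set.range (partitionClass (n := n) q₁ q₂) := by
  let p : n.Partition := ⟨l, fun h => hl _ h, by simpa using hn⟩
  refine ⟨p, ?_⟩
  have hp : (partList p).Perm l := Multiset.coe_eq_coe.mp (coe_partList p)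
  obtain ⟨g, -, hg⟩ := (isBraidSeq_sigmaSeq n).exists_semiconjBy_blocks hp (partList_pos p) 0
    (by rw [sum_partList]; omega)
  have hc : partitionClosedBraid p = closure (blocks (sigmaSeq n) 0 l) := by
    rw [partitionClosedBraid, partitionBraid_eq_blocks]
    refine ConjClasses.mk_eq_mk_iff_isConj.mpr (isConj_iff.mpr ⟨g, ?_⟩)
    rw [hg.eq, mul_inv_cancel_right]
  rw [partitionClass, hc, ← braidToHecke_blocks]
  rfl

theorem span_partitionClass :
    Submodule.span R (Set.range (partitionClass (n := n) q₁ q₂)) = ⊤ := by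
  rw [eq_top_iff]
  rintro x -
  obtain ⟨x, rfl⟩ := Submodule.mkQ_surjective (commutatorSpan n q₁ q₂) x
  have hx : x ∈ blockSpan R (heckeSeq n q₁ q₂) n := by
    refine strandAlg_le_blockSpan (isBraidSeq_heckeSeq n q₁ q₂)
      (fun i hi => heckeSeq_mul_self n q₁ q₂ hi) n (by omega) ?_
    rw [strandAlg_heckeSeq]
    exact (Algebra.mem_top : x ∈ (⊤ : Subalgebra R (HeckeAlgebra n q₁ q₂)))
  have hle : blockSpan R (heckeSeq n q₁ q₂) n ≤
      (Submodule.span R (Set.range (partitionClass (n := n) q₁ q₂))).comap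
        (commutatorSpan n q₁ q₂).mkQ := by
    refine sup_le ?_ (Submodule.span_le.mpr ?_)
    · refine Submodule.span_le.mpr ?_
      rintro _ ⟨a, -, b, rfl⟩
      have : (commutatorSpan n q₁ q₂).mkQ (a * b - b * a) = 0 :=
        (Submodule.Quotient.mk_eq_zero _).mpr (Submodule.subset_span ⟨a, b, rfl⟩)
      rw [SetLike.mem_coe, Submodule.mem_comap, this]
      exact zero_mem _
    · rintro _ ⟨l, hl, hn, rfl⟩
      exact Submodule.subset_span (mkQ_blocks_mem q₁ q₂ hl hn)
  exact hle hx

end Sequences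

/-! ### Traces of the action on words -/

section Traces

variable {R : Type*} [CommRing R] (n : ℕ) (q₁ q₂ : Rˣ)

/-- The action of the Hecke algebra on the functions of words with `n` letters. -/
def wordRep : HeckeAlgebra n q₁ q₂ →ₐ[R] Module.End R ((Fin n → Fin n) → R) :=
  RingQuot.liftAlgHom R ⟨FreeAlgebra.lift R fun i : Gen n =>
    wordOp (q₁ : R) (q₂ : R) (⟨i.1 - 1, by have := i.2; omega⟩ : Fin n) ⟨i.1, i.2.2⟩, by
    intro x y h
    induction h with
    | comm i j h =>
      have := i.2
      have := j.2
      rw [lt_abs] at h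
      simp only [map_mul, FreeAlgebra.lift_ι_apply]
      refine wordOp_comm _ _ ?_ ?_ ?_ ?_ <;> rw [Ne, Fin.mk.injEq] <;> omega
    | braid i j h =>
      obtain ⟨i, hi⟩ := i
      obtain ⟨j, hj⟩ := j
      simp only [map_mul, FreeAlgebra.lift_ι_apply]
      simp only at h
      rcases (abs_eq zero_le_one).mp h with h | h
      · obtain rfl : i = j + 1 := by omega
        refine (wordOp_braid _ _ ?_ ?_ ?_).symm <;> rw [Ne, Fin.mk.injEq] <;> omega
      · obtain rfl : j = i + 1 := by omega
        refine wordOp_braid _ _ ?_ ?_ ?_ <;> rw [Ne, Fin.mk.injEq] <;> omega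
    | quad i =>
      simp only [map_mul, map_sub, FreeAlgebra.lift_ι_apply, AlgHom.commutes, map_zero]
      exact wordOp_quad _ _ _ _⟩

theorem wordRep_T (i : Gen n) : wordRep n q₁ q₂ (T q₁ q₂ i) =
    wordOp (q₁ : R) (q₂ : R) (⟨i.1 - 1, by have := i.2; omega⟩ : Fin n) ⟨i.1, i.2.2⟩ := by
  rw [T, wordRep, RingQuot.liftAlgHom_mkAlgHom_apply, FreeAlgebra.lift_ι_apply]

theorem wordRep_heckeSeq {i : ℕ} (h : i + 1 < n) : wordRep n q₁ q₂ (heckeSeq n q₁ q₂ i) =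
    wordOp (q₁ : R) (q₂ : R) (⟨i, by omega⟩ : Fin n) ⟨i + 1, h⟩ := by
  rw [heckeSeq_of_lt _ _ h, wordRep_T]
  rfl

/-- The projection to the functions supported on the words with given content. -/
def contentProj (R : Type*) [CommRing R] (n : ℕ) (c : Multiset ℕ) :
    Module.End R ((Fin n → Fin n) → R) where
  toFun f w := if content w = c then f w else 0
  map_add' f g := by
    ext w
    simp only [Pi.add_apply]
    split_ifs <;> simp
  map_smul' r f := by
    ext w
    simp only [Pi.smul_apply, RingHom.id_apply]
    split_ifs <;> simp

theorem contentProj_apply (c : Multiset ℕ) (f : (Fin n → Fin n) → R) (w : Fin n → Fin n) :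
    contentProj R n c f w = if content w = c then f w else 0 := rfl

theorem commute_contentProj_wordRep (c : Multiset ℕ) (x : HeckeAlgebra n q₁ q₂) :
    Commute (wordRep n q₁ q₂ x) (contentProj R n c) := by
  have hx : x ∈ strandAlg R (heckeSeq n q₁ q₂) n := by
    rw [strandAlg_heckeSeq]
    exact Algebra.mem_top
  induction hx using Algebra.adjoin_induction with
  | mem x hx =>
    obtain ⟨i, hi, rfl⟩ := hx
    rw [wordRep_heckeSeq _ _ _ hi]
    refine LinearMap.ext fun f => funext fun w => ?_
    simp only [Module.End.mul_apply, wordOp_apply, contentProj_apply, content_perm]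
    split_ifs <;> simp
  | algebraMap r =>
    rw [AlgHom.commutes]
    exact Algebra.commutes r _
  | add x y _ _ hx hy =>
    rw [map_add]
    exact hx.add_left hy
  | mul x y _ _ hx hy =>
    rw [map_mul]
    exact hx.mul_left hy

/-- The trace of the action on the functions supported on the words with given content. -/
noncomputable def contentTrace (c : Multiset ℕ) : traceFunctions n q₁ q₂ :=
  ⟨LinearMap.trace R ((Fin n → Fin n) → R) ∘ₗ LinearMap.mulLeft R (contentProj R n c) ∘ₗ
    (wordRep n q₁ q₂).toLinearMap, fun a b => by
      simp only [LinearMap.comp_apply, LinearMap.mulLeft_apply, AlgHom.toLinearMap_apply, map_mul]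
      rw [← mul_assoc, ← (commute_contentProj_wordRep n q₁ q₂ c a).eq, mul_assoc,
        LinearMap.trace_mul_comm, mul_assoc]⟩

theorem contentTrace_apply (c : Multiset ℕ) (x : HeckeAlgebra n q₁ q₂) :
    (contentTrace n q₁ q₂ c).1 x =
      ∑ w : Fin n → Fin n, if content w = c then wordRep n q₁ q₂ x (Pi.single w 1) w else 0 := by
  change LinearMap.trace R ((Fin n → Fin n) → R) (contentProj R n c * wordRep n q₁ q₂ x) = _
  rw [LinearMap.trace_eq_matrix_trace R (Pi.basisFun R _), Matrix.trace]
  refine Finset.sum_congr rfl fun w _ => ?_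
  rw [Matrix.diag_apply, LinearMap.toMatrix_apply, Pi.basisFun_apply, Pi.basisFun_repr]
  rfl

/-- The pairs of endomorphisms of function spaces compatible with a change of the base ring. -/
def intertwining {S : Type*} [CommRing S] (φ : R →+* S) (X : Type*) :
    Submonoid (Module.End R (X → R) × Module.End S (X → S)) where
  carrier := {p | ∀ f : X → R, φ ∘ p.1 f = p.2 (φ ∘ f)}
  one_mem' _ := rfl
  mul_mem' {p p'} hp hp' f := by
    change φ ∘ p.1 (p'.1 f) = p.2 (p'.2 (φ ∘ f))
    rw [hp, hp']

/-- Compatibility with `φ` is closed under composition, so it is enough to check it for generators.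
Running the product in the submonoid `intertwining` of pairs treats both rings at once. -/
theorem wordRep_blocks_map {S : Type*} [CommRing S] (φ : R →+* S) (k : ℕ) (l : List ℕ)
    (f : (Fin n → Fin n) → R) :
    φ ∘ wordRep n q₁ q₂ (blocks (heckeSeq n q₁ q₂) k l) f =
      wordRep n (Units.map (φ : R →* S) q₁) (Units.map (φ : R →* S) q₂)
        (blocks (heckeSeq n (Units.map (φ : R →* S) q₁) (Units.map (φ : R →* S) q₂)) k l) (φ ∘ f) := by
  let s : ℕ → Module.End R ((Fin n → Fin n) → R) × Module.End S ((Fin n → Fin n) → S) := fun i =>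
    (wordRep n q₁ q₂ (heckeSeq n q₁ q₂ i), wordRep n (Units.map (φ : R →* S) q₁) (Units.map (φ : R →* S) q₂)
      (heckeSeq n (Units.map (φ : R →* S) q₁) (Units.map (φ : R →* S) q₂) i))
  have h : blocks s k l ∈ intertwining φ (Fin n → Fin n) := by
    refine blocks_mem fun i _ _ => ?_
    rcases Nat.lt_or_ge (i + 1) n with h | h
    · intro g
      simp only [s]
      rw [wordRep_heckeSeq _ _ _ h, wordRep_heckeSeq _ _ _ h]
      ext w
      simp only [Function.comp_apply, wordOp_apply]
      split_ifs <;> simp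
    · simp only [s, heckeSeq_of_ge _ _ h, map_one]
      exact Submonoid.one_mem _
  have h1 : (blocks s k l).1 = wordRep n q₁ q₂ (blocks (heckeSeq n q₁ q₂) k l) :=
    (map_blocks (MonoidHom.fst _ _) s k l).trans
      (map_blocks (wordRep n q₁ q₂).toMonoidHom _ k l).symm
  have h2 : (blocks s k l).2 = wordRep n (Units.map (φ : R →* S) q₁) (Units.map (φ : R →* S) q₂)
      (blocks (heckeSeq n (Units.map (φ : R →* S) q₁) (Units.map (φ : R →* S) q₂)) k l) :=
    (map_blocks (MonoidHom.snd _ _) s k l).trans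
      (map_blocks (wordRep n (Units.map (φ : R →* S) q₁) (Units.map (φ : R →* S) q₂)).toMonoidHom _ k l).symm
  rw [← h1, ← h2]
  exact h f

theorem map_contentTrace_blocks {S : Type*} [CommRing S] (φ : R →+* S) (c : Multiset ℕ)
    (k : ℕ) (l : List ℕ) :
    φ ((contentTrace n q₁ q₂ c).1 (blocks (heckeSeq n q₁ q₂) k l)) =
      (contentTrace n (Units.map (φ : R →* S) q₁) (Units.map (φ : R →* S) q₂) c).1
        (blocks (heckeSeq n (Units.map (φ : R →* S) q₁) (Units.map (φ : R →* S) q₂)) k l) := by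
  rw [contentTrace_apply, contentTrace_apply, map_sum]
  refine Finset.sum_congr rfl fun w _ => ?_
  have h := congrFun (wordRep_blocks_map n q₁ q₂ φ k l (Pi.single w 1)) w
  have e : φ ∘ (Pi.single w 1 : (Fin n → Fin n) → R) = Pi.single w 1 := by
    ext w'
    simp only [Function.comp_apply, Pi.single_apply]
    split_ifs <;> simp
  rw [e] at h
  rw [← h]
  split_ifs <;> simp

/-- The action of permutations of positions on the functions of words. -/
def permEnd (R : Type*) [CommRing R] (n : ℕ) :
    Equiv.Perm (Fin n) →* Module.End R ((Fin n → Fin n) → R) where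
  toFun p :=
    { toFun := fun f w => f (w ∘ p)
      map_add' := fun _ _ => rfl
      map_smul' := fun _ _ => rfl }
  map_one' := rfl
  map_mul' _ _ := rfl

/-- At these parameters `q₁ + q₂ = 0` and `-q₁ q₂ = 1`, so all three branches of `wordOp` reduce to
exchanging two positions. -/
theorem wordRep_blocks_one_neg_one (k : ℕ) (l : List ℕ) :
    wordRep n (1 : ℤˣ) (-1) (blocks (heckeSeq n (1 : ℤˣ) (-1)) k l) =
      permEnd ℤ n (blocks (adjSwap n) k l) := by
  refine (map_blocks (wordRep n (1 : ℤˣ) (-1)).toMonoidHom _ k l).trans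
    (Eq.trans ?_ (map_blocks (permEnd ℤ n) _ k l).symm)
  congr 1
  ext1 i
  rcases Nat.lt_or_ge (i + 1) n with h | h
  · refine (wordRep_heckeSeq _ _ _ h).trans (LinearMap.ext fun f => funext fun w => ?_)
    change _ = f (w ∘ adjSwap n i)
    rw [wordOp_apply, adjSwap, dif_pos h]
    split_ifs with h1 h2
    · rw [Units.val_one, one_mul]
      congr 1
      ext1 x
      simp only [Function.comp_apply, Equiv.swap_apply_def]
      split_ifs with h3 h4
      · rw [h3, h1]
      · rw [h4, h1]
      · rfl
    · rfl
    · simp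
  · rw [heckeSeq_of_ge _ _ h, adjSwap, dif_neg (by omega), map_one]
    exact (map_one (permEnd ℤ n)).symm

theorem contentTrace_one_neg_one (c : Multiset ℕ) (l : List ℕ) :
    (contentTrace n (1 : ℤˣ) (-1) c).1 (blocks (heckeSeq n (1 : ℤˣ) (-1)) 0 l) =
      ((Finset.univ.filter fun w : Fin n → Fin n =>
        content w = c ∧ w ∘ (blocks (adjSwap n) 0 l : Equiv.Perm (Fin n)) = w).card : ℤ) := by
  rw [contentTrace_apply, Finset.card_filter, Nat.cast_sum]
  refine Finset.sum_congr rfl fun w _ => ?_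
  rw [wordRep_blocks_one_neg_one]
  change (if content w = c then (Pi.single w 1 : (Fin n → Fin n) → ℤ)
    (w ∘ (blocks (adjSwap n) 0 l : Equiv.Perm (Fin n))) else 0) = _
  rw [Pi.single_apply, ite_and]
  split_ifs <;> simp

end Traces

/-! ### Linear independence -/

section Independence

variable {R : Type*} [CommRing R] {n : ℕ} {q₁ q₂ : Rˣ}

/-- The linear function on `V` induced by a trace function. -/
def traceDesc (tr : traceFunctions n q₁ q₂) : V n q₁ q₂ →ₗ[R] R :=
  (commutatorSpan n q₁ q₂).liftQ tr.1 (Submodule.span_le.mpr (by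
    rintro _ ⟨a, b, rfl⟩
    rw [SetLike.mem_coe, LinearMap.mem_ker, map_sub, tr.2 a b, sub_self]))

theorem traceDesc_mkQ (tr : traceFunctions n q₁ q₂) (x : HeckeAlgebra n q₁ q₂) :
    traceDesc tr ((commutatorSpan n q₁ q₂).mkQ x) = tr.1 x := rfl

theorem traceDesc_partitionClass (tr : traceFunctions n q₁ q₂) (p : n.Partition) :
    traceDesc tr (partitionClass q₁ q₂ p) =
      tr.1 (blocks (heckeSeq n q₁ q₂) 0 (partList p)) := by
  rw [partitionClass_eq, traceDesc_mkQ, partitionBraid_eq_blocks, braidToHecke_blocks]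

/-- The trace function induced by a linear function on `V`. -/
def traceOfDual (f : V n q₁ q₂ →ₗ[R] R) : traceFunctions n q₁ q₂ :=
  ⟨f ∘ₗ (commutatorSpan n q₁ q₂).mkQ, fun a b => by
    rw [LinearMap.comp_apply, LinearMap.comp_apply, ← sub_eq_zero, ← map_sub, ← map_sub,
      show (commutatorSpan n q₁ q₂).mkQ (a * b - b * a) = 0 from
        (Submodule.Quotient.mk_eq_zero _).mpr (Submodule.subset_span ⟨a, b, rfl⟩), map_zero]⟩

theorem traceDesc_traceOfDual (f : V n q₁ q₂ →ₗ[R] R) : traceDesc (traceOfDual f) = f := by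
  ext x
  rfl

/-- Let `v` be a kernel vector and `j` an index of maximal rank in its support. In row `j` only the
diagonal term survives, so `M j j * v j = 0`, a contradiction. This avoids refining the rank to a
linear order. -/
theorem det_ne_zero_of_triangular {ι S : Type*} [Fintype ι] [DecidableEq ι] [CommRing S]
    [IsDomain S] (M : Matrix ι ι S) (r : ι → ℕ) (hd : ∀ i, M i i ≠ 0)
    (hr : ∀ i j, M i j ≠ 0 → r i ≤ r j ∧ (r i = r j → i = j)) : M.det ≠ 0 := by
  classical
  intro h0
  obtain ⟨v, hv, hM⟩ := Matrix.exists_mulVec_eq_zero_iff.mpr h0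
  have hne : (Finset.univ.filter fun j => v j ≠ 0).Nonempty := by
    obtain ⟨j, hj⟩ := Function.ne_iff.mp hv
    exact ⟨j, by simpa using hj⟩
  obtain ⟨j, hj, hmax⟩ := Finset.exists_max_image _ r hne
  have hj' : v j ≠ 0 := by simpa using hj
  have h := congrFun hM j
  rw [Matrix.mulVec, dotProduct, Finset.sum_eq_single j] at h
  · exact mul_ne_zero (hd j) hj' h
  · intro k _ hk
    by_contra hne'
    obtain ⟨h1, h2⟩ := hr j k (left_ne_zero_of_mul hne')
    exact hk (h2 (le_antisymm h1 (hmax k (by simpa using right_ne_zero_of_mul hne')))).symm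
  · simp

theorem det_contentTrace_one_neg_one (hn : 0 < n) :
    (Matrix.of fun p p' : n.Partition => (contentTrace n (1 : ℤˣ) (-1) p.parts).1
      (blocks (heckeSeq n (1 : ℤˣ) (-1)) 0 (partList p'))).det ≠ 0 := by
  have : Nonempty (Fin n) := ⟨⟨0, hn⟩⟩
  refine det_ne_zero_of_triangular _ (fun p => p.parts.card) (fun p => ?_) fun p p' h => ?_
  · rw [Matrix.of_apply, contentTrace_one_neg_one, Nat.cast_ne_zero, Finset.card_ne_zero]
    obtain ⟨w, hw, hw'⟩ := exists_content_eq (partList_pos p) (sum_partList p)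
    refine ⟨w, ?_⟩
    rw [Finset.mem_filter]
    exact ⟨Finset.mem_univ _, by rw [hw, coe_partList], funext hw'⟩
  · rw [Matrix.of_apply, contentTrace_one_neg_one, Nat.cast_ne_zero, Finset.card_ne_zero] at h
    obtain ⟨w, hw⟩ := h
    obtain ⟨-, hw, hw'⟩ := Finset.mem_filter.mp hw
    obtain ⟨h1, h2⟩ := content_of_blocks_mem_preserving (partList_pos p') (sum_partList p')
      (fun x => congrFun hw' x)
    rw [← Multiset.coe_card, coe_partList, hw] at h1 h2
    exact ⟨h1, fun e => Nat.Partition.ext (h2 e)⟩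

/-- The map `φ` sends the determinant of the matrix of content traces to the nonzero integral one.
Applying the traces to a linear relation puts its coefficients in the kernel of that matrix. -/
theorem linearIndependent_partitionClass_of_specialization [IsDomain R] (hn : 0 < n) (φ : R →+* ℤ)
    (h1 : Units.map (φ : R →* ℤ) q₁ = 1) (h2 : Units.map (φ : R →* ℤ) q₂ = -1) :
    LinearIndependent R (partitionClass (n := n) q₁ q₂) := by
  let M : Matrix n.Partition n.Partition R := Matrix.of fun p p' =>
    (contentTrace n q₁ q₂ p.parts).1 (blocks (heckeSeq n q₁ q₂) 0 (partList p'))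
  have hM : M.det ≠ 0 := by
    intro h0
    apply det_contentTrace_one_neg_one hn
    rw [← map_zero φ, ← h0, RingHom.map_det]
    congr 1
    ext p p'
    refine Eq.trans ?_ (map_contentTrace_blocks n q₁ q₂ φ p.parts 0 (partList p')).symm
    rw [h1, h2, Matrix.of_apply]
  rw [Fintype.linearIndependent_iff]
  intro g hg
  refine congrFun (Matrix.eq_zero_of_mulVec_eq_zero hM (funext fun p => ?_))
  have := congrArg (traceDesc (contentTrace n q₁ q₂ p.parts)) hg
  rw [map_sum, map_zero] at this
  rw [Pi.zero_apply, ← this, Matrix.mulVec, dotProduct]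
  refine Finset.sum_congr rfl fun p' _ => ?_
  rw [map_smul, traceDesc_partitionClass, smul_eq_mul, mul_comm]
  rfl

end Independence

/-! ### Change of the base ring -/

section BaseChange

open TensorProduct

variable {A R : Type*} [CommRing A] [CommRing R] [Algebra A R] (n : ℕ) (u₁ u₂ : Aˣ)

/-- The homomorphism to the base change of the Hecke algebra. -/
def toBaseChange : HeckeAlgebra n (Units.map (algebraMap A R : A →* R) u₁)
    (Units.map (algebraMap A R : A →* R) u₂) →ₐ[R] R ⊗[A] HeckeAlgebra n u₁ u₂ :=
  RingQuot.liftAlgHom R ⟨FreeAlgebra.lift R fun i : Gen n => 1 ⊗ₜ[A] T u₁ u₂ i, by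
    intro x y h
    induction h with
    | comm i j h =>
      simp only [map_mul, FreeAlgebra.lift_ι_apply, Algebra.TensorProduct.tmul_mul_tmul,
        T_comm u₁ u₂ i j h]
    | braid i j h =>
      simp only [map_mul, FreeAlgebra.lift_ι_apply, Algebra.TensorProduct.tmul_mul_tmul,
        T_braid u₁ u₂ i j h]
    | quad i =>
      have e : ∀ u : A, algebraMap R (R ⊗[A] HeckeAlgebra n u₁ u₂) (algebraMap A R u) =
          1 ⊗ₜ[A] algebraMap A _ u := fun u => by
        rw [Algebra.TensorProduct.algebraMap_apply, Algebra.algebraMap_self, RingHom.id_apply,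
          Algebra.algebraMap_eq_smul_one, Algebra.algebraMap_eq_smul_one, TensorProduct.smul_tmul]
      simp only [map_mul, map_sub, FreeAlgebra.lift_ι_apply, AlgHom.commutes, map_zero,
        Units.coe_map, MonoidHom.coe_coe, e]
      rw [← TensorProduct.tmul_sub, ← TensorProduct.tmul_sub,
        Algebra.TensorProduct.tmul_mul_tmul, T_quad, TensorProduct.tmul_zero]⟩

theorem toBaseChange_T (i : Gen n) : toBaseChange (R := R) n u₁ u₂ (T _ _ i) =
    1 ⊗ₜ[A] T u₁ u₂ i := by
  rw [T, toBaseChange, RingQuot.liftAlgHom_mkAlgHom_apply, FreeAlgebra.lift_ι_apply]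

theorem toBaseChange_blocks (k : ℕ) (l : List ℕ) :
    toBaseChange (R := R) n u₁ u₂ (blocks (heckeSeq n _ _) k l) =
      1 ⊗ₜ[A] blocks (heckeSeq n u₁ u₂) k l := by
  refine (map_blocks (toBaseChange (R := R) n u₁ u₂).toMonoidHom _ k l).trans (Eq.trans ?_
    (map_blocks (Algebra.TensorProduct.includeRight :
      HeckeAlgebra n u₁ u₂ →ₐ[A] R ⊗[A] HeckeAlgebra n u₁ u₂).toMonoidHom _ k l).symm)
  congr 1
  ext1 i
  rcases Nat.lt_or_ge (i + 1) n with h | h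
  · rw [heckeSeq_of_lt _ _ h, heckeSeq_of_lt _ _ h]
    exact toBaseChange_T n u₁ u₂ _
  · rw [heckeSeq_of_ge _ _ h, heckeSeq_of_ge _ _ h, map_one, map_one]

variable {n u₁ u₂}

/-- The extension of a trace function to a larger base ring. -/
noncomputable def traceBaseChange (f : traceFunctions n u₁ u₂) :
    traceFunctions n (Units.map (algebraMap A R : A →* R) u₁)
      (Units.map (algebraMap A R : A →* R) u₂) :=
  ⟨(TensorProduct.AlgebraTensorModule.rid A R R).toLinearMap ∘ₗ f.1.baseChange R ∘ₗ
    (toBaseChange n u₁ u₂).toLinearMap, fun a b => by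
      simp only [LinearMap.comp_apply, AlgHom.toLinearMap_apply, map_mul]
      generalize toBaseChange (R := R) n u₁ u₂ a = x
      generalize toBaseChange (R := R) n u₁ u₂ b = y
      congr 1
      induction x using TensorProduct.induction_on with
      | zero => rw [zero_mul, mul_zero]
      | add x x' hx hx' => rw [add_mul, mul_add, map_add, map_add, hx, hx']
      | tmul r x =>
        induction y using TensorProduct.induction_on with
        | zero => rw [zero_mul, mul_zero]
        | add y y' hy hy' => rw [add_mul, mul_add, map_add, map_add, hy, hy']
        | tmul s y =>
          rw [Algebra.TensorProduct.tmul_mul_tmul, Algebra.TensorProduct.tmul_mul_tmul,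
            LinearMap.baseChange_tmul, LinearMap.baseChange_tmul, mul_comm r s, f.2 x y]⟩

theorem traceBaseChange_blocks (f : traceFunctions n u₁ u₂) (k : ℕ) (l : List ℕ) :
    (traceBaseChange (R := R) f).1 (blocks (heckeSeq n _ _) k l) =
      algebraMap A R (f.1 (blocks (heckeSeq n u₁ u₂) k l)) := by
  change TensorProduct.AlgebraTensorModule.rid A R R (f.1.baseChange R
    (toBaseChange n u₁ u₂ (blocks (heckeSeq n _ _) k l))) = _
  rw [toBaseChange_blocks, LinearMap.baseChange_tmul, TensorProduct.AlgebraTensorModule.rid_tmul,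
    Algebra.algebraMap_eq_smul_one]

theorem linearIndependent_partitionClass_baseChange
    (h : LinearIndependent A (partitionClass (n := n) u₁ u₂)) :
    LinearIndependent R (partitionClass (n := n) (Units.map (algebraMap A R : A →* R) u₁)
      (Units.map (algebraMap A R : A →* R) u₂)) := by
  classical
  -- Spanning is known over every base ring, so independence over `A` supplies coordinate functions.
  -- Extended to `R`, the one for `p` extracts the coefficient `g p` of the relation. Only a
  -- homomorphism into the base change is needed for this, not an isomorphism.
  let v := Module.Basis.mk h (span_partitionClass u₁ u₂).ge
  rw [Fintype.linearIndependent_iff]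
  intro g hg p
  have hv : ∀ p', (traceOfDual (v.coord p)).1 (blocks (heckeSeq n u₁ u₂) 0 (partList p')) =
      if p' = p then 1 else 0 := by
    intro p'
    rw [← traceDesc_partitionClass, traceDesc_traceOfDual,
      ← Module.Basis.mk_apply h (span_partitionClass u₁ u₂).ge p', Module.Basis.coord_apply,
      Module.Basis.repr_self, Finsupp.single_apply]
  have := congrArg (traceDesc (traceBaseChange (R := R) (traceOfDual (v.coord p)))) hg
  simpa only [map_sum, map_smul, traceDesc_partitionClass, traceBaseChange_blocks, hv, map_zero,
    smul_eq_mul, apply_ite (algebraMap A R), map_one, mul_ite, mul_one, mul_zero,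
    Finset.sum_ite_eq', Finset.mem_univ, if_true] using this

end BaseChange

/-! ### The generic base ring -/

section Generic

open MvPolynomial

/-- The ring of integral Laurent polynomials in two variables. -/
abbrev GenericRing : Type := Localization.Away (X 0 * X 1 : MvPolynomial (Fin 2) ℤ)

instance : IsDomain GenericRing :=
  IsLocalization.isDomain_localization (powers_le_nonZeroDivisors_of_noZeroDivisors
    (mul_ne_zero (X_ne_zero 0) (X_ne_zero 1)))

theorem isUnit_genericRing_mul :
    IsUnit (algebraMap (MvPolynomial (Fin 2) ℤ) GenericRing (X 0) *
      algebraMap (MvPolynomial (Fin 2) ℤ) GenericRing (X 1)) := by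
  rw [← map_mul]
  exact IsLocalization.Away.algebraMap_isUnit _

/-- The first variable of the generic ring, as a unit. -/
noncomputable def genericUnit₁ : GenericRingˣ :=
  (isUnit_of_mul_isUnit_left isUnit_genericRing_mul).unit

/-- The second variable of the generic ring, as a unit. -/
noncomputable def genericUnit₂ : GenericRingˣ :=
  (isUnit_of_mul_isUnit_right isUnit_genericRing_mul).unit

theorem exists_genericRing_hom {S : Type*} [CommRing S] (a b : Sˣ) :
    ∃ φ : GenericRing →+* S, Units.map (φ : GenericRing →* S) genericUnit₁ = a ∧
      Units.map (φ : GenericRing →* S) genericUnit₂ = b := by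
  let ψ : MvPolynomial (Fin 2) ℤ →+* S := eval₂Hom (Int.castRingHom S) ![(a : S), b]
  have h0 : ψ (X 0) = a := by simp [ψ]
  have h1 : ψ (X 1) = b := by simp [ψ]
  have hu : IsUnit (ψ (X 0 * X 1)) := by
    rw [map_mul, h0, h1]
    exact (a * b).isUnit
  obtain ⟨φ, hφ⟩ : ∃ φ : GenericRing →+* S, ∀ x, φ (algebraMap _ GenericRing x) = ψ x :=
    ⟨IsLocalization.Away.lift _ hu, IsLocalization.Away.lift_eq _ hu⟩
  exact ⟨φ, Units.ext ((hφ _).trans h0), Units.ext ((hφ _).trans h1)⟩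

end Generic

/-- The generic ring is used through two specializations: one to the integers at `1` and `-1`, which
detects that the determinant is nonzero, and one to `R` at the given parameters, along which
independence is transported. -/
theorem linearIndependent_partitionClass {R : Type*} [CommRing R] {n : ℕ} (hn : 0 < n)
    (q₁ q₂ : Rˣ) : LinearIndependent R (partitionClass (n := n) q₁ q₂) := by
  obtain ⟨φ, h1, h2⟩ := exists_genericRing_hom (1 : ℤˣ) (-1)
  have h := linearIndependent_partitionClass_of_specialization hn φ h1 h2
  obtain ⟨χ, rfl, rfl⟩ := exists_genericRing_hom q₁ q₂
  let := χ.toAlgebra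
  exact linearIndependent_partitionClass_baseChange (R := R) h

/-- The basis of `V` given by the classes of the braids `b_λ`. -/
noncomputable def partitionBasis {R : Type*} [CommRing R] {n : ℕ} (hn : 0 < n) (q₁ q₂ : Rˣ) :
    Module.Basis n.Partition R (V n q₁ q₂) :=
  Module.Basis.mk (linearIndependent_partitionClass hn q₁ q₂) (span_partitionClass q₁ q₂).ge

/-- Trace functions are the linear functions on `V`. -/
def traceEquivDual {R : Type*} [CommRing R] (n : ℕ) (q₁ q₂ : Rˣ) :
    traceFunctions n q₁ q₂ ≃ₗ[R] (V n q₁ q₂ →ₗ[R] R) where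
  toFun := traceDesc
  invFun := traceOfDual
  left_inv _ := rfl
  right_inv := traceDesc_traceOfDual
  map_add' f g := by
    ext x
    rfl
  map_smul' c f := by
    ext x
    rfl

end IwahoriHecke

theorem theorem5p1 {R : Type*} [CommRing R] [IsDomain R] (n : ℕ) (hn : 0 < n) (q₁ q₂ : Rˣ) :
    (∃ v : Module.Basis (Nat.Partition n) R (IwahoriHecke.V n q₁ q₂),
      ∀ p : Nat.Partition n,
        v p = IwahoriHecke.closedBraidClass q₁ q₂ (IwahoriHecke.partitionClosedBraid p)) ∧
    (∃ e : IwahoriHecke.traceFunctions n q₁ q₂ ≃ₗ[R] (Nat.Partition n → R),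
      ∀ (tr : IwahoriHecke.traceFunctions n q₁ q₂) (p : Nat.Partition n),
        e tr p =
          tr.1 (IwahoriHecke.braidToHecke q₁ q₂ (IwahoriHecke.partitionBraid p)).1) := by
  have hv : ∀ p, IwahoriHecke.partitionBasis hn q₁ q₂ p =
      IwahoriHecke.closedBraidClass q₁ q₂ (IwahoriHecke.partitionClosedBraid p) :=
    fun p => Module.Basis.mk_apply _ _ p
  refine ⟨⟨IwahoriHecke.partitionBasis hn q₁ q₂, hv⟩,
    (IwahoriHecke.traceEquivDual n q₁ q₂).trans
      ((IwahoriHecke.partitionBasis hn q₁ q₂).constr R).symm, fun tr p => ?_⟩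
  change IwahoriHecke.traceDesc tr (IwahoriHecke.partitionBasis hn q₁ q₂ p) = _
  rw [hv]
  rfl
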